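/- **Conventions.** A *frequency* is a strictly increasing sequence $\lambda=(\lambda_n)_{n\in\mathbb N}$ of non-negative real numbers. We write $\lambda=(R,B)$ if $B=(b_k)_{k=1}^N$, $N\in\mathbb N\cup\{\infty\}$, is a $\mathbb Q$-linearly independent sequence of real numbers (a basis of length $N$) and $R=(r^n_k)$ is a matrix of rationals (the Bohr matrix) whose rows $R_n=(r^n_k)_k$ have only finitely many non-zero entries, such that $\lambda_n=\sum_k r^n_k b_k$ for all $n$. For a compact abelian group $G$ with normalized Haar measure, a set $E\subset\widehat G$ of characters and $1\le p\le\infty$, $H_p^E(G)$ is the subspace of all $f\in L_p(G)$ with $\widehat f(\gamma)=0$ for all $\gamma\in\widehat G\setminus E$, where $\widehat f(\gamma)=\int_G f\,\overline\gamma$. A *$\lambda$-Dirichlet group* is a compact abelian (Hausdorff) group $G$ together with a continuous homomorphism $\beta:\mathbb R\to G$ with dense range such that for every $n$ there is a (necessarily unique) character $h_{\lambda_n}$ of $G$ with $h_{\lambda_n}(\beta(t))=e^{-i\lambda_n t}$ for all $t\in\mathbb R$. Then $H_p^\lambda(G):=H_p^E(G)$ with $E=\{h_{\lambda_n}: n\in\mathbb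 N\}$, and $\mathcal H_p(\lambda)$ is the space of all formal Dirichlet series $D=\sum a_n(D)e^{-\lambda_n s}$ for which there is $f\in H_p^\lambda(G)$ with $a_n(D)=\widehat f(h_{\lambda_n})$ for all $n$, with the norm $\|D\|_p=\|f\|_p$. $\overline{\mathbb R}$ is the Bohr compactification of $\mathbb R$, i.e. the dual group of $\mathbb R$ with the discrete topology, with $\beta(x)=[t\mapsto e^{-ixt}]$; its character $h_x$ is the evaluation at $x\in\mathbb R$, and we write $\widehat f(x)$ for $\widehat f(h_x)$. $\widehat{\mathbb Q_d}$ is the dual group of $\mathbb Q$ with the discrete topology; the dual of $\widehat{\mathbb Q_d}^N$ is $\bigoplus_{k=1}^N\mathbb Q$ via $r\mapsto[(\chi_k)_k\mapsto\prod_k\chi_k(r_k)]$, the dual of $\mathbb T^N$ is $\bigoplus_{k=1}^N\mathbb Z$ via $\alpha\mapsto[z\mapsto z^\alpha]$, and $H_p^R$ denotes $H_p^E$ for $E$ the set of the rows of $R$. Finally, $\mathcal H_p$ is the Hardy space of ordinary Dirichlet series: all $\sum_{m\ge1} b_m m^{-s}$ for which there is $F\in L_p(\mathbb T^\infty)$,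 with $\widehat F(\alpha)\ne0$ only if $\alpha\ge0$, such that $b_m=\widehat F(\alpha)$ whenever $m=\mathfrak p^\alpha=\prod_k \mathfrak p_k^{\alpha_k}$ ($\mathfrak p_1<\mathfrak p_2<\dots$ the primes), with the norm $\|F\|_p$. **Theorem.** Let $1\le p\le\infty$, let $\lambda=(R,B)$ be a frequency with a basis of length $N\in\mathbb N\cup\{\infty\}$, and let $\mathcal H_p(\lambda)$ be formed with an arbitrary $\lambda$-Dirichlet group $(G,\beta)$. Then the norm of $\mathcal H_p(\lambda)$ is well defined, and (isometries being linear): 1. There are a unique isometry of $H_p^R(\widehat{\mathbb Q_d}^N)$ onto $\mathcal H_p(\lambda)$, a unique isometry of $\mathcal H_p(\lambda)$ onto $H_p^\lambda(\overline{\mathbb R})$, and a unique isometry of $H_p^R(\widehat{\mathbb Q_d}^N)$ onto $H_p^\lambda(\overline{\mathbb R})$, such that whenever $F$, $D$, $f$ are associated to each other by them, then for each $n$ $$\widehat F(R_n)=a_n(D)=\widehat f(\lambda_n).$$ 2. If all entries of $R$ are integers, then there is a unique isometry $D\mapsto F$ of $\mathcal H_p(\lambda)$ onto $H_p^R(\mathbb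 T^N)$ such that $\widehat F(\alpha)=a_n(D)$ whenever $\alpha$ is the $n$th row of $R$. 3. If all entries of $R$ belong to $\mathbb N_0$, then there is a unique isometry of $\mathcal H_p(\lambda)$ into $\mathcal H_p$, $\sum a_n e^{-\lambda_n s}\mapsto\sum b_m m^{-s}$, such that $b_{\mathfrak p^\alpha}=a_n$ whenever $\alpha$ is the $n$th row of $R$, and $b_m=0$ for all $m$ which are not of the form $\mathfrak p^\alpha$ with a row $\alpha$ of $R$. For $1<p<\infty$ the isometry is unique already among those which satisfy the first of these two conditions. -/

import Mathlib

open MeasureTheory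
open scoped ENNReal

/-! ### The range of a linear map as a seminormed space -/

section RangeSpace

variable {V W : Type*} [NormedAddCommGroup V] [NormedSpace ℂ V] [AddCommGroup W] [Module ℂ W]

/-- The range of a linear map `T : V → W`, to be endowed with the norm
`‖y‖ = inf {‖v‖ : T v = y}`, which is `‖T v‖ = ‖v‖` for injective `T`. -/
def RangeSpace (T : V →ₗ[ℂ] W) : Type _ := LinearMap.range T

namespace RangeSpace

variable {T : V →ₗ[ℂ] W}

noncomputable instance : AddCommGroup (RangeSpace T) :=
  inferInstanceAs (AddCommGroup (LinearMap.range T))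

noncomputable instance : Module ℂ (RangeSpace T) :=
  inferInstanceAs (Module ℂ (LinearMap.range T))

/-- The element of `W`. -/
def val (y : RangeSpace T) : W := y.1

/-- `T`, as a map onto its range. -/
noncomputable def mk (T : V →ₗ[ℂ] W) : V →ₗ[ℂ] RangeSpace T := T.rangeRestrict

/-- The range of `T` as a quotient space of `V`. -/
noncomputable def toQuotient : RangeSpace T ≃ₗ[ℂ] (V ⧸ LinearMap.ker T) :=
  T.quotKerEquivRange.symm

/-- The quotient norm. -/
noncomputable instance : SeminormedAddCommGroup (RangeSpace T) :=
  SeminormedAddCommGroup.induced _ _ (toQuotient (T := T))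

noncomputable instance : NormedSpace ℂ (RangeSpace T) :=
  NormedSpace.induced ℂ (RangeSpace T) (V ⧸ LinearMap.ker T) (toQuotient (T := T)).toLinearMap

theorem val_mk (v : V) : (mk T v).val = T v := rfl

/-- The norm is the infimum of the norms of the preimages. -/
theorem norm_eq_sInf (y : RangeSpace T) : ‖y‖ = sInf (norm '' {v : V | T v = y.val}) := by
  obtain ⟨v, rfl⟩ : ∃ v, mk T v = y := T.surjective_rangeRestrict y
  have h1 : toQuotient (mk T v) = (LinearMap.ker T).mkQ v := (LinearEquiv.symm_apply_eq _).2 rfl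
  have h2 : ‖mk T v‖ = ‖QuotientAddGroup.mk' (LinearMap.ker T).toAddSubgroup v‖ :=
    congrArg (fun z : V ⧸ LinearMap.ker T => ‖z‖) h1
  rw [h2, quotient_norm_mk_eq, val_mk]
  congr 1
  ext r
  constructor
  · rintro ⟨w, hw, rfl⟩
    have hw' : T w = 0 := hw
    exact ⟨v + w, by simp [hw'], rfl⟩
  · rintro ⟨w, hw, rfl⟩
    have hw' : T w = T v := hw
    refine ⟨w - v, ?_, by simp⟩
    change T (w - v) = 0
    rw [map_sub, hw', sub_self]

theorem norm_mk_of_injective (hT : Function.Injective T) (v : V) : ‖mk T v‖ = ‖v‖ := by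
  rw [norm_eq_sInf]
  have : {w : V | T w = (mk T v).val} = {v} := by
    ext w
    exact hT.eq_iff
  rw [this, Set.image_singleton, csInf_singleton]

end RangeSpace

end RangeSpace

/-! ### Compact abelian groups and their Hardy spaces -/

section Hardy

/-- The normalized Haar measure of a compact group. -/
noncomputable def haarProb (G : Type*) [CommGroup G] [TopologicalSpace G] [IsTopologicalGroup G]
    [CompactSpace G] [MeasurableSpace G] [BorelSpace G] : Measure G :=
  Measure.haarMeasure (⊤ : TopologicalSpace.PositiveCompacts G)

variable {G : Type*} [CommGroup G] [TopologicalSpace G] [IsTopologicalGroup G]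
  [CompactSpace G] [MeasurableSpace G] [BorelSpace G]

instance haarProb.instIsProbabilityMeasure : IsProbabilityMeasure (haarProb G) :=
  ⟨by
    have h := Measure.haarMeasure_self (K₀ := (⊤ : TopologicalSpace.PositiveCompacts G))
    simpa [haarProb] using h⟩

theorem integrable_mul_char (p : ℝ≥0∞) [hp : Fact (1 ≤ p)] (f : Lp ℂ p (haarProb G))
    (γ : PontryaginDual G) :
    Integrable (fun x => f x * (starRingEnd ℂ) (γ x : ℂ)) (haarProb G) := by
  have hf : Integrable f (haarProb G) := (Lp.memLp f).integrable hp.out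
  have hc : Continuous fun x => (starRingEnd ℂ) (γ x : ℂ) :=
    Complex.continuous_conj.comp (continuous_subtype_val.comp (map_continuous γ))
  refine hf.mul_bdd (c := 1) hc.aestronglyMeasurable (Filter.Eventually.of_forall fun x => ?_)
  rw [RCLike.norm_conj, Circle.norm_coe]

/-- The Fourier coefficient `∫ f(x) conj(γ(x)) dx` of `f ∈ L_p(G)` at the character `γ`. -/
noncomputable def fourierCoeffAt (p : ℝ≥0∞) [Fact (1 ≤ p)] (γ : PontryaginDual G) :
    Lp ℂ p (haarProb G) →ₗ[ℂ] ℂ where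
  toFun f := ∫ x, f x * (starRingEnd ℂ) (γ x : ℂ) ∂(haarProb G)
  map_add' f g := by
    rw [← integral_add (integrable_mul_char p f γ) (integrable_mul_char p g γ)]
    refine integral_congr_ae ?_
    filter_upwards [Lp.coeFn_add f g] with x hx
    rw [hx, Pi.add_apply, add_mul]
  map_smul' c f := by
    rw [RingHom.id_apply, smul_eq_mul, ← integral_const_mul]
    refine integral_congr_ae ?_
    filter_upwards [Lp.coeFn_smul c f] with x hx
    rw [hx, Pi.smul_apply, smul_eq_mul, mul_assoc]

/-- `H_p^E(G)`: all `f ∈ L_p(G)` whose Fourier transform is supported by `E`,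
with the norm of `L_p(G)`. -/
noncomputable def hardy (p : ℝ≥0∞) [Fact (1 ≤ p)] (E : Set (PontryaginDual G)) :
    Submodule ℂ (Lp ℂ p (haarProb G)) where
  carrier := {f | ∀ γ, fourierCoeffAt p γ f ≠ 0 → γ ∈ E}
  zero_mem' γ h := absurd (map_zero _) h
  add_mem' {f g} hf hg γ h := by
    by_contra hγ
    have h1 : fourierCoeffAt p γ f = 0 := by_contra fun h' => hγ (hf γ h')
    have h2 : fourierCoeffAt p γ g = 0 := by_contra fun h' => hγ (hg γ h')
    exact h (by rw [map_add, h1, h2, add_zero])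
  smul_mem' c f hf γ h := hf γ fun h' => h (by rw [map_smul, h', smul_zero])

variable {I : Type*}

/-- The map sending `f ∈ H_p^E(G)` to the family of its Fourier coefficients at the
characters `χ i`. -/
noncomputable def coeffMap (p : ℝ≥0∞) [Fact (1 ≤ p)] (E : Set (PontryaginDual G))
    (χ : I → PontryaginDual G) : hardy p E →ₗ[ℂ] (I → ℂ) :=
  LinearMap.pi fun i => (fourierCoeffAt p (χ i)).comp (hardy p E).subtype

/-- The space of all families `a : I → ℂ` for which there is `f ∈ H_p^E(G)` with
`a i = \hat f (χ i)` for all `i`, with the norm `‖a‖ = ‖f‖_p` (more precisely, the infimum of these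
norms, as long as `f` is not known to be determined by `a`). -/
abbrev CoeffSpace (p : ℝ≥0∞) [Fact (1 ≤ p)] (E : Set (PontryaginDual G))
    (χ : I → PontryaginDual G) : Type _ :=
  RangeSpace (coeffMap p E χ)

/-- The family of coefficients of an element of the coefficient space. -/
noncomputable def CoeffSpace.coeff {p : ℝ≥0∞} [Fact (1 ≤ p)] {E : Set (PontryaginDual G)}
    {χ : I → PontryaginDual G} (D : CoeffSpace p E χ) : I → ℂ := D.val

end Hardy

/-! ### Dirichlet groups and Hardy spaces of general Dirichlet series -/

/-- A frequency: a strictly increasing sequence of nonnegative real numbers. -/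
def IsFrequency (lam : ℕ → ℝ) : Prop := StrictMono lam ∧ ∀ n, 0 ≤ lam n

section DirichletGroups

variable {G : Type*} [CommGroup G] [TopologicalSpace G]

/-- `(G, β)` is a Dirichlet group: `β` is a continuous homomorphism from the additive group of the
reals to `G`, with dense range. -/
structure IsDirichletGroup (β : ℝ → G) : Prop where
  map_add : ∀ s t, β (s + t) = β s * β t
  continuous : Continuous β
  denseRange : DenseRange β

/-- The character `γ` of `G` extends `t ↦ exp(-ixt)` along `β`. -/
def Extends (β : ℝ → G) (x : ℝ) (γ : PontryaginDual G) : Prop :=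
  ∀ t, γ (β t) = Circle.exp (-(x * t))

/-- `(G, β)` is a `λ`-Dirichlet group. -/
structure IsLambdaDirichletGroup (lam : ℕ → ℝ) (β : ℝ → G) : Prop extends
    IsDirichletGroup β where
  exists_extends : ∀ n, ∃ γ, Extends β (lam n) γ

/-- The character `h_{λ_n}` of a `λ`-Dirichlet group (unique, as `β` has dense range). -/
noncomputable def IsLambdaDirichletGroup.char {lam : ℕ → ℝ} {β : ℝ → G}
    (h : IsLambdaDirichletGroup lam β) (n : ℕ) : PontryaginDual G :=
  (h.exists_extends n).choose

theorem IsLambdaDirichletGroup.char_spec {lam : ℕ → ℝ} {β : ℝ → G}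
    (h : IsLambdaDirichletGroup lam β) (n : ℕ) : Extends β (lam n) (h.char n) :=
  (h.exists_extends n).choose_spec

variable [IsTopologicalGroup G] [CompactSpace G] [MeasurableSpace G] [BorelSpace G]

/-- `H_p^λ(G)`, for `(G, β)`. -/
noncomputable abbrev hardyLambda (p : ℝ≥0∞) [Fact (1 ≤ p)] (lam : ℕ → ℝ) (β : ℝ → G) :
    Submodule ℂ (Lp ℂ p (haarProb G)) :=
  hardy p {γ | ∃ n, Extends β (lam n) γ}

/-- The Hardy space `𝓗_p(λ)` of `λ`-Dirichlet series `D = ∑ a_n e^{-λ_n s}` (realized by the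
`λ`-Dirichlet group `(G, β)`): all those for which there is `f ∈ H_p^λ(G)` with
`a_n = \hat f (h_{λ_n})` for all `n`, and then `‖D‖_p = ‖f‖_p`. A formal Dirichlet series is its
sequence of coefficients. -/
abbrev HardyDirichlet (p : ℝ≥0∞) [Fact (1 ≤ p)] {lam : ℕ → ℝ} {β : ℝ → G}
    (h : IsLambdaDirichletGroup lam β) : Type _ :=
  CoeffSpace p {γ | ∃ n, Extends β (lam n) γ} h.char

/-- The Bohr map `H_p^λ(G) → 𝓗_p(λ)`. -/
noncomputable def bohrMap (p : ℝ≥0∞) [Fact (1 ≤ p)] {lam : ℕ → ℝ} {β : ℝ → G}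
    (h : IsLambdaDirichletGroup lam β) : hardyLambda p lam β →ₗ[ℂ] HardyDirichlet p h :=
  RangeSpace.mk (coeffMap p _ h.char)

end DirichletGroups

/-! ### Duals of discrete groups, the Bohr compactification, and powers of the dual of `ℚ` -/

/-- The additive group `A`, written multiplicatively and endowed with the discrete topology. -/
def DiscreteCopy (A : Type*) : Type _ := Multiplicative A

namespace DiscreteCopy

variable {A : Type*}

instance [AddCommGroup A] : CommGroup (DiscreteCopy A) :=
  inferInstanceAs (CommGroup (Multiplicative A))

instance : TopologicalSpace (DiscreteCopy A) := ⊥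

instance : DiscreteTopology (DiscreteCopy A) := ⟨rfl⟩

instance [h : Countable A] : Countable (DiscreteCopy A) := h

/-- The element `a` of `A` in its discrete copy. -/
def of (a : A) : DiscreteCopy A := Multiplicative.ofAdd a

theorem of_add [AddCommGroup A] (a b : A) : of (a + b) = of a * of b := rfl

end DiscreteCopy

/-- The compact dual group of the additive group `A` with the discrete topology. -/
abbrev DiscreteDual (A : Type*) [AddCommGroup A] : Type _ := PontryaginDual (DiscreteCopy A)

noncomputable instance PontryaginDual.instMeasurableSpaceBorel {A : Type*} [Monoid A] [TopologicalSpace A] :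
    MeasurableSpace (PontryaginDual A) := borel _

instance PontryaginDual.instBorelSpaceBorel {A : Type*} [Monoid A] [TopologicalSpace A] :
    BorelSpace (PontryaginDual A) := ⟨rfl⟩

/-- Needed so that the product σ-algebra of countably many copies of the dual of `ℚ` is the Borel
σ-algebra of the product. -/
instance DiscreteDual.instSecondCountableTopology {A : Type*} [AddCommGroup A] [Countable A] :
    SecondCountableTopology (DiscreteDual A) :=
  (ContinuousMonoidHom.isInducing_toContinuousMap (DiscreteCopy A) Circle).secondCountableTopology

/-- Evaluation at `a ∈ A`, as a character of the dual of `A`. -/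
noncomputable def evalChar {A : Type*} [AddCommGroup A] (a : A) : PontryaginDual (DiscreteDual A) :=
  ({ toFun := fun χ => χ (DiscreteCopy.of a)
     map_one' := rfl
     map_mul' := fun _ _ => rfl
     continuous_toFun :=
      (ContinuousMonoidHom.instContinuousEvalConst (DiscreteCopy A) Circle).continuous_eval_const
        (DiscreteCopy.of a) } : DiscreteDual A →ₜ* Circle)

/-- The Bohr compactification of the reals. -/
abbrev BohrR : Type := DiscreteDual ℝ

/-- The embedding `x ↦ [t ↦ exp(-ixt)]` of the reals into their Bohr compactification. -/
noncomputable def bohrEmbedding (x : ℝ) : BohrR :=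
  ({ toFun := fun t => Circle.exp (-(x * (Multiplicative.toAdd (show Multiplicative ℝ from t))))
     map_one' := by
      change Circle.exp (-(x * 0)) = 1
      simp
     map_mul' := fun s t => by
      change Circle.exp (-(x * ((show ℝ from s) + (show ℝ from t)))) = _
      rw [mul_add, neg_add, Circle.exp_add]
      rfl
     continuous_toFun := continuous_of_discreteTopology } : DiscreteCopy ℝ →ₜ* Circle)

/-- The index set `{1, …, N}` (shifted to start at `0`), for `N ∈ ℕ ∪ {∞}`. -/
abbrev Ix (N : ℕ∞) : Type := {k : ℕ // (k : ℕ∞) < N}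

/-- The compact group `\hat{ℚ_d}^N`. -/
abbrev QDualPow (N : ℕ∞) : Type := Ix N → DiscreteDual ℚ

/-- The finite rational sequence `r`, as the character `(χ_k) ↦ ∏ χ_k(r_k)` of `\hat{ℚ_d}^N`. -/
noncomputable def rowChar {N : ℕ∞} (r : Ix N →₀ ℚ) : PontryaginDual (QDualPow N) :=
  ({ toFun := fun χ => ∏ k ∈ r.support, evalChar (r k) (χ k)
     map_one' := by simp
     map_mul' := fun χ ψ => by simp [Finset.prod_mul_distrib]
     continuous_toFun := continuous_finsetProd _ fun k _ =>
      (map_continuous (evalChar (r k))).comp (continuous_apply k) } : QDualPow N →ₜ* Circle)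

noncomputable instance Circle.instMeasurableSpaceBorel : MeasurableSpace Circle := borel _

instance Circle.instBorelSpaceBorel : BorelSpace Circle := ⟨rfl⟩

/-- The torus `𝕋^N`. -/
abbrev Torus (N : ℕ∞) : Type := Ix N → Circle

/-- The finite integer sequence `α`, as the character `z ↦ z^α = ∏ z_k ^ α_k` of `𝕋^N`. -/
noncomputable def monomialChar {N : ℕ∞} (α : Ix N →₀ ℤ) : PontryaginDual (Torus N) :=
  ({ toFun := fun z => ∏ k ∈ α.support, z k ^ α k
     map_one' := by simp
     map_mul' := fun z w => by simp [mul_zpow, Finset.prod_mul_distrib]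
     continuous_toFun := continuous_finsetProd _ fun k _ =>
      (continuous_apply k).zpow (α k) } : Torus N →ₜ* Circle)

/-! ### Bohr matrices -/

/-- `λ = (R, B)`: the sequence `B` of length `N` is `ℚ`-linearly independent and
`λ_n = ∑ r^n_k b_k`, where `R n` is the `n`th (finite) row of `R`. -/
def IsDecomposition {N : ℕ∞} (lam : ℕ → ℝ) (R : ℕ → (Ix N →₀ ℚ)) (B : Ix N → ℝ) : Prop :=
  LinearIndependent ℚ B ∧ ∀ n, lam n = (R n).sum fun k r => (r : ℝ) * B k

/-- All entries of `R` are integers. -/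
def IsIntegerMatrix {N : ℕ∞} (R : ℕ → (Ix N →₀ ℚ)) : Prop := ∀ n k, ∃ a : ℤ, R n k = a

/-- All entries of `R` are natural numbers (zero included). -/
def IsNaturalMatrix {N : ℕ∞} (R : ℕ → (Ix N →₀ ℚ)) : Prop := ∀ n k, ∃ a : ℕ, R n k = a

/-- The multi-index `α` is the `n`th row of `R`. -/
def IsRow {N : ℕ∞} (R : ℕ → (Ix N →₀ ℚ)) (n : ℕ) (α : Ix N →₀ ℤ) : Prop :=
  ∀ k, R n k = α k

/-- `H_p^R(\hat{ℚ_d}^N)`. -/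
noncomputable abbrev hardyQDual (p : ℝ≥0∞) [Fact (1 ≤ p)] {N : ℕ∞} (R : ℕ → (Ix N →₀ ℚ)) :
    Submodule ℂ (Lp ℂ p (haarProb (QDualPow N))) :=
  hardy p (Set.range fun n => rowChar (R n))

/-- `H_p^R(𝕋^N)`, for a matrix `R` of integers. -/
noncomputable abbrev hardyTorus (p : ℝ≥0∞) [Fact (1 ≤ p)] {N : ℕ∞} (R : ℕ → (Ix N →₀ ℚ)) :
    Submodule ℂ (Lp ℂ p (haarProb (Torus N))) :=
  hardy p {γ | ∃ n α, IsRow R n α ∧ γ = monomialChar α}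

/-! ### Ordinary Dirichlet series -/

/-- The prime `p_k`, where `p_0 < p_1 < …` enumerates all primes. -/
noncomputable abbrev nthPrime (k : ℕ) : ℕ := Nat.nth Nat.Prime k

/-- The number `𝔭^α = ∏ p_k ^ α_k`, for a multi-index `α ≥ 0`. -/
noncomputable def primePower {N : ℕ∞} (α : Ix N →₀ ℤ) : ℕ :=
  ∏ k ∈ α.support, nthPrime k ^ (α k).toNat

theorem nthPrime_injective : Function.Injective fun k : Ix ⊤ => nthPrime k := fun _ _ h =>
  Subtype.ext (Nat.nth_injective Nat.infinite_setOfPred_prime h)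

/-- The exponents in the prime factorization of `m`: the multi-index `α ≥ 0` with `𝔭^α = m`. -/
noncomputable def primeExponents (m : ℕ+) : Ix ⊤ →₀ ℤ :=
  ((m : ℕ).factorization.comapDomain (fun k : Ix ⊤ => nthPrime k)
    nthPrime_injective.injOn).mapRange (fun a : ℕ => (a : ℤ)) rfl

/-- The Hardy space `𝓗_p` of ordinary Dirichlet series `∑ b_m m^{-s}`: the isometric image of
`H_p(𝕋^∞) = {f ∈ L_p(𝕋^∞) : \hat f (α) ≠ 0 ⇒ α ≥ 0}` under the identification
`b_m = \hat f (α)` for `m = 𝔭^α`. -/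
abbrev HardyOrdinary (p : ℝ≥0∞) [Fact (1 ≤ p)] : Type :=
  CoeffSpace (G := Torus ⊤) p {γ | ∃ α, 0 ≤ α ∧ γ = monomialChar α}
    fun m : ℕ+ => monomialChar (primeExponents m)

/-! All the spaces involved are realizations of a single one. Let `A` be the group generated by the
rows of `R`, made discrete, and let `Â` be its compact dual. If `A` embeds by `ι` into the dual of a
compact abelian group `G`, then dualizing gives a continuous homomorphism `π : G → Â`. It carries
Haar measure to Haar measure, because a nontrivial character of `Â` pulls back to a nontrivial
character of `G`, and both have integral 0 (`measurePreserving_dualMap`). So `f ↦ f ∘ π` is an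
isometry of `L_p(Â)` into `L_p(G)` which moves the Fourier coefficient at `a` to `ι a`, and it maps
the functions with spectrum in `S` onto those with spectrum in `ι '' S` (`map_pullLp_hardy`). For `p
= 1`, surjectivity is the density of trigonometric polynomials; for every other `p`, including `∞`,
an `L_1`-preimage is automatically `p`-integrable, since `π` preserves the measure.

It remains to embed `A` into several duals: by `rowChar` for the powers of the dual of `ℚ`; by `r ↦
∑ r_k b_k` for the Bohr compactification, injectively because `B` is linearly independent; by
extension along `β` for a Dirichlet group; by monomials for a torus when `R` is integral. Unique
factorization then translates the torus statement into ordinary Dirichlet series.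

Uniqueness of the isometries rests on the uniqueness theorem for Fourier coefficients, hence on the
fact that characters separate points. The latter is obtained from Gelfand theory, applied to the
translations of `L_2(G)` together with a smoothing operator. In the last assertion not all
coefficients of the image are prescribed; for `1 < p < ∞` strict convexity compensates
(`eq_charLp_of_norm_le_one`): an isometry must send characters to characters. -/

/-! ### Characters of compact abelian groups separate the points -/

section Separation

set_option linter.unusedSectionVars false

/-- The double commutant of a commutative self-adjoint set is a commutative C⋆-algebra. -/
theorem exists_characterSpace_map_ne {A : Type*} [CStarAlgebra A] {s : Set A}
    (hcomm : ∀ a ∈ s, ∀ b ∈ s, a * b = b * a) (hstar : ∀ a ∈ s, star a ∈ s)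
    {c d : A} (hc : c ∈ s) (hd : d ∈ s) (u : A) (hu : u ∈ s) (hcd : u * c ≠ d) :
    ∃ S : StarSubalgebra ℂ A, s ⊆ S ∧ ∃ φ : S →⋆ₐ[ℂ] ℂ, Continuous φ ∧
      ∃ (hc : c ∈ S) (hd : d ∈ S) (hu : u ∈ S), φ ⟨u, hu⟩ * φ ⟨c, hc⟩ ≠ φ ⟨d, hd⟩ := by
  let S : StarSubalgebra ℂ A :=
    StarSubalgebra.centralizer ℂ (StarSubalgebra.centralizer ℂ s : Set A)
  have hsS : s ⊆ S := fun a ha => by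
    refine (StarSubalgebra.mem_centralizer_iff ℂ).2 fun g hg => ?_
    obtain ⟨h1, h2⟩ := (StarSubalgebra.mem_centralizer_iff ℂ).1 hg a ha
    refine ⟨h1.symm, ?_⟩
    have := congrArg star h2
    simpa using this
  have hS : IsClosed (S : Set A) := by
    have : (S : Set A) = _ := StarSubalgebra.coe_centralizer_centralizer ℂ s
    rw [this]
    exact Set.isClosed_centralizer _
  -- Since `s` commutes with itself, `s ⊆ s'`, hence `s'' ⊆ s'`; elements of `s''` therefore commute
  -- with one another.
  have hsub : s ⊆ StarSubalgebra.centralizer ℂ s := fun a ha =>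
    (StarSubalgebra.mem_centralizer_iff ℂ).2 fun g hg =>
      ⟨hcomm g hg a ha, hcomm _ (hstar g hg) a ha⟩
  have hSc : S ≤ StarSubalgebra.centralizer ℂ s :=
    StarSubalgebra.centralizer_le ℂ _ _ hsub
  have hmul : ∀ x y : S, x * y = y * x := fun x y => Subtype.ext
    ((StarSubalgebra.mem_centralizer_iff ℂ).1 y.2 x (hSc x.2)).1
  let inst : CommCStarAlgebra S :=
    { StarSubalgebra.cstarAlgebra S (h_closed := hS) with mul_comm := hmul }
  have hne : (⟨u, hsS hu⟩ * ⟨c, hsS hc⟩ : S) ≠ ⟨d, hsS hd⟩ := fun h =>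
    hcd (congrArg Subtype.val h)
  have h1 := (gelfandTransform_isometry S).injective.ne hne
  obtain ⟨φ, hφ⟩ := DFunLike.ne_iff.1 h1
  refine ⟨S, hsS, (φ : S →⋆ₐ[ℂ] ℂ), ?_, hsS hc, hsS hd, hsS hu, ?_⟩
  · exact map_continuous φ
  · rw [← map_mul]
    exact hφ

/-- A commuting family of unitaries `U x` and an operator `S` commuting with them, such that
`x ↦ U x * S` is continuous, give rise to a character. -/
theorem exists_pontryaginDual_ne_one {G A : Type*} [CommGroup G] [TopologicalSpace G]
    [CStarAlgebra A] (U : G →* A) (hU : ∀ x, star (U x) = U x⁻¹) (S : A)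
    (hS : ∀ x, U x * S = S * U x) (hcont : Continuous fun x => U x * S) {x₀ : G}
    (hx₀ : U x₀ * S ≠ S) : ∃ γ : PontryaginDual G, γ x₀ ≠ 1 := by
  -- `S` need not be normal; `T` is self-adjoint, so that `T` and the `U x` form a commuting
  -- self-adjoint set.
  set T := star S * S with hT
  have hS' : ∀ x, U x * star S = star S * U x := fun x => by
    have := congrArg star (hS x⁻¹)
    simpa [hU] using this.symm
  have hUT : ∀ x, U x * T = T * U x := fun x => by
    rw [hT, ← mul_assoc, hS', mul_assoc, hS, ← mul_assoc]
  have hUU : ∀ x y, U x * U y = U y * U x := fun x y => by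
    rw [← map_mul, mul_comm, map_mul]
  -- If `U x₀` fixed `T`, all four terms of `(U x₀ S - S)⋆ (U x₀ S - S)` would equal `T`, up to
  -- sign, and cancel.
  have hTne : U x₀ * T ≠ T := fun h => by
    refine hx₀ (sub_eq_zero.1 ((CStarRing.star_mul_self_eq_zero_iff _).1 ?_))
    have h1 : star S * (U x₀ * S) = T := by rw [← mul_assoc, ← hS', mul_assoc, h]
    have h2 : star (U x₀ * S) * S = T := by
      have := congrArg star h1
      simpa [hT] using this
    have h3 : star (U x₀ * S) * (U x₀ * S) = T := by
      rw [star_mul, hU, mul_assoc, ← mul_assoc (U _), ← map_mul, inv_mul_cancel, map_one, one_mul]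
    rw [star_sub, sub_mul, mul_sub, mul_sub, h1, h2, h3]
    simp [hT]
  let s : Set A := insert T (Set.range U)
  have hTs : star T = T := by simp [hT]
  obtain ⟨B, hsB, φ, hφ, hTB, hTB', hUB, hne⟩ := exists_characterSpace_map_ne (s := s) (c := T)
    (d := T) (u := U x₀)
    (by
      rintro a (rfl | ⟨x, rfl⟩) b (rfl | ⟨y, rfl⟩)
      · rfl
      · exact (hUT y).symm
      · exact hUT x
      · exact hUU x y)
    (by
      rintro a (rfl | ⟨x, rfl⟩)
      · exact Or.inl hTs
      · exact Or.inr ⟨x⁻¹, (hU x).symm⟩)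
    (Or.inl rfl) (Or.inl rfl) (Or.inr ⟨x₀, rfl⟩) hTne
  have hmem : ∀ x, U x ∈ B := fun x => hsB (Or.inr ⟨x, rfl⟩)
  let V : G →* B :=
    { toFun := fun x => ⟨U x, hmem x⟩
      map_one' := Subtype.ext (map_one U)
      map_mul' := fun x y => Subtype.ext (map_mul U x y) }
  let ψ : G →* ℂ := (φ : B →* ℂ).comp V
  have hψ : ∀ x, ψ x = φ ⟨U x, hmem x⟩ := fun x => rfl
  have hψs : ∀ x, star (ψ x) = ψ x⁻¹ := fun x => by
    rw [hψ, ← map_star]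
    exact congrArg φ (Subtype.ext (hU x))
  have hnorm : ∀ x, ‖ψ x‖ = 1 := fun x => by
    have h1 : star (ψ x) * ψ x = 1 := by rw [hψs, ← map_mul, inv_mul_cancel, map_one]
    have h2 : ‖ψ x‖ * ‖ψ x‖ = 1 := by rw [← CStarRing.norm_star_mul_self, h1, norm_one]
    nlinarith [norm_nonneg (ψ x)]
  -- `x ↦ U x` itself need not be norm continuous, but `φ (U x) = φ (U x * T) / φ T` is continuous
  -- in `x`.
  have hT0 : φ ⟨T, hTB⟩ ≠ 0 := fun h => hne (by rw [h, mul_zero])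
  have hψc : Continuous ψ := by
    have h1 : Continuous fun x => φ (⟨U x, hmem x⟩ * ⟨T, hTB⟩) := by
      refine hφ.comp (Continuous.subtype_mk (f := fun x => U x * T) ?_ _)
      have : (fun x => U x * T) = fun x => star S * (U x * S) := by
        funext x
        rw [hT, ← mul_assoc, hS', mul_assoc]
      rw [this]
      exact hcont.const_mul _
    have h2 : ⇑ψ = fun x => φ (⟨U x, hmem x⟩ * ⟨T, hTB⟩) / φ ⟨T, hTB⟩ := by
      funext x
      rw [map_mul, mul_div_cancel_right₀ _ hT0, hψ]
    rw [h2]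
    exact h1.div_const _
  let γ : G →ₜ* Circle :=
    { toFun := fun x => ⟨ψ x, mem_sphere_zero_iff_norm.2 (hnorm x)⟩
      map_one' := Subtype.ext (map_one ψ)
      map_mul' := fun x y => Subtype.ext (map_mul ψ x y)
      continuous_toFun := Continuous.subtype_mk hψc _ }
  refine ⟨γ, fun h => hne ?_⟩
  have h1 : ψ x₀ = 1 := congrArg Subtype.val h
  rw [hψ] at h1
  rw [h1, one_mul]

/-! ### Translations on `L_p(G)` and the smoothing operator. -/

variable {G : Type*} [CommGroup G] [TopologicalSpace G] [IsTopologicalGroup G]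
  [CompactSpace G] [MeasurableSpace G] [BorelSpace G]

instance haarProb.instIsHaarMeasure : (haarProb G).IsHaarMeasure :=
  inferInstanceAs (Measure.haarMeasure _).IsHaarMeasure

instance haarProb.instRegular [T2Space G] : (haarProb G).Regular :=
  inferInstanceAs (Measure.haarMeasure _).Regular

/-- Translation by `x` on `L_p(G)`. -/
noncomputable def translateLp (p : ℝ≥0∞) [Fact (1 ≤ p)] (x : G) :
    Lp ℂ p (haarProb G) →ₗᵢ[ℂ] Lp ℂ p (haarProb G) :=
  Lp.compMeasurePreservingₗᵢ ℂ (x * ·) (measurePreserving_mul_left (haarProb G) x)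

theorem translateLp_toLp (p : ℝ≥0∞) [Fact (1 ≤ p)] (x : G) (f : C(G, ℂ)) :
    translateLp p x (ContinuousMap.toLp p (haarProb G) ℂ f) =
      ContinuousMap.toLp p (haarProb G) ℂ (f.comp (ContinuousMap.mulLeft x)) := by
  rfl

theorem coeFn_translateLp (p : ℝ≥0∞) [Fact (1 ≤ p)] (x : G) (f : Lp ℂ p (haarProb G)) :
    translateLp p x f =ᵐ[haarProb G] fun y => f (x * y) :=
  Lp.coeFn_compMeasurePreserving f (measurePreserving_mul_left (haarProb G) x)

theorem translateLp_one (p : ℝ≥0∞) [Fact (1 ≤ p)] (f : Lp ℂ p (haarProb G)) :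
    translateLp p 1 f = f := by
  refine Lp.ext ?_
  filter_upwards [coeFn_translateLp p 1 f] with y hy
  rw [hy, one_mul]

theorem translateLp_mul (p : ℝ≥0∞) [Fact (1 ≤ p)] (x y : G) (f : Lp ℂ p (haarProb G)) :
    translateLp p (x * y) f = translateLp p x (translateLp p y f) := by
  refine Lp.ext ?_
  filter_upwards [coeFn_translateLp p (x * y) f, coeFn_translateLp p x (translateLp p y f),
    (measurePreserving_mul_left (haarProb G) x).quasiMeasurePreserving.ae
      (coeFn_translateLp p y f)] with z h1 h2 h3
  rw [h1, h2, h3, mul_comm x y, mul_assoc]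

theorem continuous_translateLp [T2Space G] {p : ℝ≥0∞} [Fact (1 ≤ p)] (hp : p ≠ ∞)
    (f : Lp ℂ p (haarProb G)) : Continuous fun x => translateLp p x f :=
  (continuous_const (y := f)).compMeasurePreservingLp
    (g := fun x : G => (ContinuousMap.mulLeft x : C(G, G)))
    (ContinuousMap.curry ⟨fun q : G × G => q.1 * q.2, continuous_mul⟩).continuous
    (fun x => measurePreserving_mul_left (haarProb G) x) hp

theorem inner_translateLp_left (x : G) (f g : Lp ℂ 2 (haarProb G)) :
    inner ℂ (translateLp 2 x f) g = inner ℂ f (translateLp 2 x⁻¹ g) := by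
  conv_lhs => rw [← translateLp_one 2 g, ← mul_inv_cancel x, translateLp_mul]
  exact (translateLp 2 x).inner_map_map _ _

/-- The map `h ↦ [x ↦ ⟨f, h(x ·)⟩]` on `L_2(G)`. -/
noncomputable def correlation [T2Space G] :
    Lp ℂ 2 (haarProb G) →L⋆[ℂ] Lp ℂ 2 (haarProb G) →L[ℂ] C(G, ℂ) :=
  LinearMap.mkContinuous₂
    (LinearMap.mk₂'ₛₗ (starRingEnd ℂ) (RingHom.id ℂ)
      (fun f h => ⟨fun x => inner ℂ f (translateLp 2 x h),
        (continuous_const.inner (continuous_translateLp (by simp) h) :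
          Continuous fun x : G => inner ℂ f (translateLp 2 x h))⟩)
      (fun f g h => by ext x; simp [inner_add_left])
      (fun c f h => by ext x; simp [inner_smul_left])
      (fun f g h => by ext x; simp [inner_add_right])
      (fun c f h => by ext x; simp [inner_smul_right])) 1
    (fun f h => by
      rw [one_mul]
      refine (ContinuousMap.norm_le _ (by positivity)).2 fun x => ?_
      refine (norm_inner_le_norm (𝕜 := ℂ) f (translateLp 2 x h)).trans ?_
      rw [LinearIsometry.norm_map])

theorem correlation_apply [T2Space G] (f h : Lp ℂ 2 (haarProb G)) (x : G) :
    correlation f h x = inner ℂ f (translateLp 2 x h) := rfl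

/-- Characters of a compact abelian Hausdorff group separate the points. -/
theorem exists_pontryaginDual_apply_ne_one [T2Space G] {x₀ : G} (hx₀ : x₀ ≠ 1) :
    ∃ γ : PontryaginDual G, γ x₀ ≠ 1 := by
  -- A Urysohn function with values 0 at `1` and 1 at `x₀` is moved by translation by `x₀`.
  obtain ⟨h, h0, h1, -⟩ := exists_continuous_zero_one_of_isClosed
    (isClosed_singleton (x := (1 : G))) (isClosed_singleton (x := x₀))
    (Set.disjoint_singleton.2 hx₀.symm)
  let k : C(G, ℂ) := ⟨fun x => (h x : ℂ), by fun_prop⟩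
  let K : Lp ℂ 2 (haarProb G) := ContinuousMap.toLp 2 (haarProb G) ℂ k
  have hK : translateLp 2 x₀ K - K ≠ 0 := fun H => by
    have h2 := ContinuousMap.toLp_injective (p := 2) (𝕜 := ℂ) (haarProb G)
      ((translateLp_toLp 2 x₀ k).symm.trans (sub_eq_zero.1 H))
    have h3 := DFunLike.congr_fun h2 1
    have h4 : h (x₀ * 1) = h 1 := Complex.ofReal_injective h3
    rw [mul_one, h0 rfl, h1 rfl] at h4
    simp at h4
  set F := translateLp 2 x₀ K - K with hF
  let J : C(G, ℂ) →L[ℂ] Lp ℂ 2 (haarProb G) := ContinuousMap.toLp 2 (haarProb G) ℂ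
  let A := Lp ℂ 2 (haarProb G) →L[ℂ] Lp ℂ 2 (haarProb G)
  let U : G →* A :=
    { toFun := fun x => (translateLp 2 x).toContinuousLinearMap
      map_one' := ContinuousLinearMap.ext fun f => translateLp_one 2 f
      map_mul' := fun x y => ContinuousLinearMap.ext fun f => translateLp_mul 2 x y f }
  -- Translating the output amounts to translating `f`. As `correlation` is bounded in `f`, this
  -- turns strong continuity of translation into norm continuity of `x ↦ U x * S`.
  have hcorr : ∀ f x, (translateLp 2 x).toContinuousLinearMap ∘L (J ∘L correlation f) =
      J ∘L correlation (translateLp 2 x⁻¹ f) := fun f x => by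
    refine ContinuousLinearMap.ext fun g => ?_
    refine (translateLp_toLp 2 x (correlation f g)).trans (congrArg J ?_)
    ext y
    change correlation f g (x * y) = correlation (translateLp 2 x⁻¹ f) g y
    rw [correlation_apply, correlation_apply, inner_translateLp_left, inv_inv, ← translateLp_mul]
  refine exists_pontryaginDual_ne_one (A := A) U (fun x => ?_) (J ∘L correlation F) (fun x => ?_)
    ?_ (x₀ := x₀) ?_
  · rw [ContinuousLinearMap.star_eq_adjoint]
    refine ((ContinuousLinearMap.eq_adjoint_iff _ _).2 fun f g => ?_).symm
    change inner ℂ (translateLp 2 x⁻¹ f) g = inner ℂ f (translateLp 2 x g)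
    rw [inner_translateLp_left, inv_inv]
  · refine (hcorr F x).trans (ContinuousLinearMap.ext fun g => congrArg J ?_)
    ext y
    change correlation _ g y = correlation F (translateLp 2 x g) y
    rw [correlation_apply, inner_translateLp_left, inv_inv, correlation_apply, ← translateLp_mul,
      ← translateLp_mul, mul_comm]
  · have h1 : (fun x => U x * (J ∘L correlation F)) =
        fun x => J ∘L correlation (translateLp 2 x⁻¹ F) := funext fun x => hcorr F x
    rw [h1]
    have h2 : Continuous fun x => correlation (translateLp 2 x⁻¹ F) :=
      correlation.continuous.comp
        ((continuous_translateLp (by simp) F).comp continuous_inv)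
    exact continuous_const.clm_comp h2
  · intro H
    -- Evaluating at `K` and at the point `1` gives `⟨F, translateLp 2 x₀ K⟩ = ⟨F, K⟩`, that is `⟨F,
    -- F⟩ = 0`.
    have h1 := DFunLike.congr_fun ((hcorr F x₀).symm.trans H) K
    have h2 := ContinuousMap.toLp_injective (p := 2) (𝕜 := ℂ) (haarProb G) h1
    have h3 : correlation (translateLp 2 x₀⁻¹ F) K 1 = correlation F K 1 := DFunLike.congr_fun h2 1
    rw [correlation_apply, correlation_apply, translateLp_one, inner_translateLp_left, inv_inv,
      ← sub_eq_zero, ← inner_sub_right, ← hF] at h3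
    exact hK (inner_self_eq_zero.1 h3)

end Separation

/-! ### Density of trigonometric polynomials -/

section Density

set_option linter.unusedSectionVars false

variable {G : Type*} [CommGroup G] [TopologicalSpace G] [IsTopologicalGroup G]
  [CompactSpace G] [MeasurableSpace G] [BorelSpace G]

/-- A character as a continuous complex-valued function. -/
noncomputable def charC (γ : PontryaginDual G) : C(G, ℂ) :=
  ⟨fun x => (γ x : ℂ), continuous_subtype_val.comp (map_continuous γ)⟩

theorem charC_apply (γ : PontryaginDual G) (x : G) : charC γ x = (γ x : ℂ) := rfl

theorem PontryaginDual.mul_apply' {A : Type*} [Monoid A] [TopologicalSpace A]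
    (γ η : PontryaginDual A) (x : A) : (γ * η) x = γ x * η x := rfl

theorem PontryaginDual.inv_apply' {A : Type*} [Monoid A] [TopologicalSpace A]
    (γ : PontryaginDual A) (x : A) : γ⁻¹ x = (γ x)⁻¹ := rfl

theorem conj_char_apply (γ : PontryaginDual G) (x : G) :
    (starRingEnd ℂ) (γ x : ℂ) = (γ⁻¹ x : Circle) := by
  rw [PontryaginDual.inv_apply', Circle.coe_inv_eq_conj]

/-- A point-separating group of characters spans a dense subspace of `C(G)`. -/
theorem span_charC_topologicalClosure (X : Subgroup (PontryaginDual G))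
    (hX : ∀ x : G, x ≠ 1 → ∃ γ ∈ X, γ x ≠ 1) :
    (Submodule.span ℂ (charC '' (X : Set (PontryaginDual G)))).topologicalClosure = ⊤ := by
  let S : StarSubalgebra ℂ C(G, ℂ) :=
    { Algebra.adjoin ℂ (charC '' (X : Set (PontryaginDual G))) with
      star_mem' := by
        change Algebra.adjoin ℂ (charC '' (X : Set (PontryaginDual G))) ≤
          star (Algebra.adjoin ℂ (charC '' (X : Set (PontryaginDual G))))
        refine Algebra.adjoin_le ?_
        rintro - ⟨γ, hγ, rfl⟩
        refine Algebra.subset_adjoin ⟨γ⁻¹, inv_mem hγ, ?_⟩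
        ext x
        exact (conj_char_apply γ x).symm }
  have hS : Subalgebra.toSubmodule S.toSubalgebra =
      Submodule.span ℂ (charC '' (X : Set (PontryaginDual G))) := by
    refine Algebra.adjoin_eq_span_of_subset ℂ (Set.Subset.trans ?_ Submodule.subset_span)
    intro x hx
    refine Submonoid.closure_induction (fun _ => id) ⟨1, one_mem X, ?_⟩ ?_ hx
    · ext x
      rfl
    · rintro _ _ _ _ ⟨γ, hγ, rfl⟩ ⟨η, hη, rfl⟩
      refine ⟨γ * η, mul_mem hγ hη, ?_⟩
      ext x
      rfl
  have hsep : S.SeparatesPoints := by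
    intro x y hxy
    obtain ⟨γ, hγ, h⟩ := hX (x * y⁻¹) (mt mul_inv_eq_one.1 hxy)
    refine ⟨charC γ, ⟨charC γ, Algebra.subset_adjoin ⟨γ, hγ, rfl⟩, rfl⟩, fun h' => h ?_⟩
    have h'' : γ x = γ y := Circle.ext h'
    rw [map_mul, h'', ← map_mul, mul_inv_cancel, map_one]
  have := ContinuousMap.starSubalgebra_topologicalClosure_eq_top_of_separatesPoints S hsep
  rw [← hS]
  exact congrArg (fun T : StarSubalgebra ℂ C(G, ℂ) => Subalgebra.toSubmodule T.toSubalgebra) this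

/-- Translation by `y` multiplies the integral by `γ y`, which can be chosen different from 1. -/
theorem integral_char_eq_zero {γ : PontryaginDual G} (hγ : γ ≠ 1) :
    ∫ x, (γ x : ℂ) ∂(haarProb G) = 0 := by
  obtain ⟨y, hy⟩ : ∃ y, γ y ≠ 1 := by
    by_contra! h
    exact hγ (PontryaginDual.ext h)
  have h1 := integral_mul_left_eq_self (μ := haarProb G) (fun x => (γ x : ℂ)) y
  simp only [map_mul, Circle.coe_mul, integral_const_mul] at h1
  by_contra h
  exact hy (Circle.ext (mul_right_cancel₀ h (by rw [h1, Circle.coe_one, one_mul])))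

/-! ### Fourier coefficients as continuous functionals; orthogonality of characters. -/

variable (p : ℝ≥0∞) [Fact (1 ≤ p)]

theorem fourierCoeffAt_apply (γ : PontryaginDual G) (f : Lp ℂ p (haarProb G)) :
    fourierCoeffAt p γ f = ∫ x, f x * (starRingEnd ℂ) (γ x : ℂ) ∂(haarProb G) := rfl

/-- On a probability space, the `L_1`-norm is at most the `L_p`-norm. -/
theorem integral_norm_le_norm_Lp (f : Lp ℂ p (haarProb G)) :
    ∫ x, ‖f x‖ ∂(haarProb G) ≤ ‖f‖ := by
  rw [integral_norm_eq_lintegral_enorm (Lp.aestronglyMeasurable f), Lp.norm_def,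
    ← eLpNorm_one_eq_lintegral_enorm]
  exact ENNReal.toReal_mono (Lp.eLpNorm_ne_top f)
    (eLpNorm_le_eLpNorm_of_exponent_le Fact.out (Lp.aestronglyMeasurable f))

theorem norm_fourierCoeffAt_le (γ : PontryaginDual G) (f : Lp ℂ p (haarProb G)) :
    ‖fourierCoeffAt p γ f‖ ≤ ‖f‖ := by
  refine (norm_integral_le_integral_norm _).trans (le_trans (le_of_eq ?_)
    (integral_norm_le_norm_Lp p f))
  simp_rw [norm_mul, RCLike.norm_conj, Circle.norm_coe, mul_one]

theorem continuous_fourierCoeffAt (γ : PontryaginDual G) :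
    Continuous (fourierCoeffAt p γ : Lp ℂ p (haarProb G) → ℂ) :=
  (LinearMap.mkContinuous (fourierCoeffAt p γ) 1
    fun f => (one_mul ‖f‖).symm ▸ norm_fourierCoeffAt_le p γ f).continuous

/-- A character as an element of `L_p(G)`. -/
noncomputable def charLp (γ : PontryaginDual G) : Lp ℂ p (haarProb G) :=
  ContinuousMap.toLp p (haarProb G) ℂ (charC γ)

theorem fourierCoeffAt_toLp (γ : PontryaginDual G) (f : C(G, ℂ)) :
    fourierCoeffAt p γ (ContinuousMap.toLp p (haarProb G) ℂ f) =
      ∫ x, f x * (starRingEnd ℂ) (γ x : ℂ) ∂(haarProb G) := by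
  refine integral_congr_ae ?_
  filter_upwards [ContinuousMap.coeFn_toLp (p := p) (𝕜 := ℂ) (haarProb G) f] with x hx
  rw [hx]

theorem fourierCoeffAt_charLp_self (γ : PontryaginDual G) :
    fourierCoeffAt p γ (charLp p γ) = 1 := by
  rw [charLp, fourierCoeffAt_toLp]
  simp [charC_apply, Complex.mul_conj, Circle.normSq_coe]

theorem fourierCoeffAt_charLp_of_ne {γ η : PontryaginDual G} (h : η ≠ γ) :
    fourierCoeffAt p γ (charLp p η) = 0 := by
  rw [charLp, fourierCoeffAt_toLp]
  have : ∀ x, charC η x * (starRingEnd ℂ) (γ x : ℂ) = ((η * γ⁻¹) x : Circle) := fun x => by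
    rw [conj_char_apply, charC_apply, PontryaginDual.mul_apply', Circle.coe_mul]
  simp_rw [this]
  exact integral_char_eq_zero (mt mul_inv_eq_one.1 h)

theorem charLp_mem_hardy {E : Set (PontryaginDual G)} {γ : PontryaginDual G} (hγ : γ ∈ E) :
    charLp p γ ∈ hardy p E := fun η hη => by
  by_cases h : γ = η
  · exact h ▸ hγ
  · exact absurd (fourierCoeffAt_charLp_of_ne p h) hη

theorem isClosed_hardy (E : Set (PontryaginDual G)) :
    IsClosed (hardy p E : Set (Lp ℂ p (haarProb G))) := by
  have : (hardy p E : Set (Lp ℂ p (haarProb G))) =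
      ⋂ γ : {γ // γ ∉ E}, {f | fourierCoeffAt p γ.1 f = 0} := by
    ext f
    simp only [Set.mem_iInter, Subtype.forall, Set.mem_ofPred_eq]
    exact forall_congr' fun γ => not_imp_comm
  rw [this]
  exact isClosed_iInter fun γ => isClosed_eq (continuous_fourierCoeffAt p _) continuous_const

/-! ### Convolution, approximate identities and the uniqueness theorem. -/

variable [T2Space G] {p}

theorem integrable_smul_translateLp (hp : p ≠ ∞) (k : C(G, ℂ)) (f : Lp ℂ p (haarProb G)) :
    Integrable (fun y => k y • translateLp p y f) (haarProb G) :=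
  (k.continuous.smul (continuous_translateLp hp f)).integrable_of_hasCompactSupport
    (HasCompactSupport.of_compactSpace _)

/-- The convolution `∫ k(y) f(y ·) dy` as an element of `L_p(G)`. -/
noncomputable def convLp (hp : p ≠ ∞) :
    C(G, ℂ) →L[ℂ] Lp ℂ p (haarProb G) →L[ℂ] Lp ℂ p (haarProb G) :=
  LinearMap.mkContinuous₂
    (LinearMap.mk₂ ℂ (fun k f => ∫ y, k y • translateLp p y f ∂(haarProb G))
      (fun k l f => by
        rw [← integral_add (integrable_smul_translateLp hp k f)
          (integrable_smul_translateLp hp l f)]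
        simp [add_smul])
      (fun c k f => by
        rw [← integral_smul]
        simp [mul_smul])
      (fun k f g => by
        rw [← integral_add (integrable_smul_translateLp hp k f)
          (integrable_smul_translateLp hp k g)]
        simp)
      (fun c k f => by
        rw [← integral_smul]
        simp [smul_comm c])) 1
    (fun k f => by
      rw [one_mul]
      refine (norm_integral_le_of_norm_le_const (C := ‖k‖ * ‖f‖)
        (Filter.Eventually.of_forall fun y => ?_)).trans (by simp)
      rw [norm_smul, LinearIsometry.norm_map]
      exact mul_le_mul_of_nonneg_right (k.norm_coe_le_norm y) (norm_nonneg _))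

theorem convLp_apply (hp : p ≠ ∞) (k : C(G, ℂ)) (f : Lp ℂ p (haarProb G)) :
    convLp hp k f = ∫ y, k y • translateLp p y f ∂(haarProb G) := rfl

/-- Convolution with a character. -/
theorem convLp_charC (hp : p ≠ ∞) (γ : PontryaginDual G) (f : Lp ℂ p (haarProb G)) :
    convLp hp (charC γ⁻¹) f = fourierCoeffAt p γ f • charLp p γ := by
  -- Both sides are continuous in `f`, so `f` may be taken continuous; the integral can then be
  -- formed in `C(G)` and evaluated pointwise.
  refine congrFun (((ContinuousMap.toLp_denseRange ℂ (haarProb G) ℂ hp).equalizer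
    (convLp hp (charC γ⁻¹)).continuous
    ((continuous_fourierCoeffAt p γ).smul continuous_const) (funext fun h => ?_))) f
  let L : C(G, ℂ) →L[ℂ] Lp ℂ p (haarProb G) := ContinuousMap.toLp p (haarProb G) ℂ
  let τ : G → C(G, ℂ) := fun y => h.comp (ContinuousMap.mulLeft y)
  have hτ : Continuous τ :=
    (ContinuousMap.curry ⟨fun q : G × G => h (q.1 * q.2), by fun_prop⟩).continuous
  have hint : Integrable (fun y => charC γ⁻¹ y • τ y) (haarProb G) :=
    ((charC γ⁻¹).continuous.smul hτ).integrable_of_hasCompactSupport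
      (HasCompactSupport.of_compactSpace _)
  have h1 : convLp hp (charC γ⁻¹) (L h) = L (∫ y, charC γ⁻¹ y • τ y ∂(haarProb G)) := by
    rw [← ContinuousLinearMap.integral_comp_comm L hint, convLp_apply]
    simp only [map_smul]
    rfl
  have h2 : ∫ y, charC γ⁻¹ y • τ y ∂(haarProb G) = fourierCoeffAt p γ (L h) • charC γ := by
    ext x
    rw [← ContinuousMap.evalCLM_apply ℂ x (∫ y, charC γ⁻¹ y • τ y ∂(haarProb G)),
      ← ContinuousLinearMap.integral_comp_comm _ hint, fourierCoeffAt_toLp]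
    rw [← integral_mul_right_eq_self (μ := haarProb G)
      (fun y => h y * (starRingEnd ℂ) (γ y : ℂ)) x, ContinuousMap.smul_apply, smul_eq_mul,
      ← integral_mul_const]
    refine integral_congr_ae (Filter.Eventually.of_forall fun y => ?_)
    have h3 : (starRingEnd ℂ) (γ x : ℂ) * (γ x : ℂ) = 1 := by
      rw [mul_comm, Complex.mul_conj, Circle.normSq_coe, Complex.ofReal_one]
    have h4 : (charC γ⁻¹ y : ℂ) = (starRingEnd ℂ) (γ y : ℂ) := (conj_char_apply γ y).symm
    change charC γ⁻¹ y * h (y * x) = _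
    simp only [map_mul, Circle.coe_mul, h4, charC_apply]
    linear_combination (-(starRingEnd ℂ) (γ y : ℂ) * h (y * x)) * h3
  change convLp hp (charC γ⁻¹) (L h) = _
  rw [h1, h2, map_smul]
  rfl

/-- A function in `L_p(G)` is in the closed span of the characters in its spectrum. -/
theorem mem_closure_span_charLp (hp : p ≠ ∞) (f : Lp ℂ p (haarProb G)) :
    f ∈ (Submodule.span ℂ (charLp p '' {γ | fourierCoeffAt p γ f ≠ 0})).topologicalClosure := by
  set W := (Submodule.span ℂ (charLp p '' {γ | fourierCoeffAt p γ f ≠ 0})).topologicalClosure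
    with hW
  have hWc : IsClosed (W : Set (Lp ℂ p (haarProb G))) := Submodule.isClosed_topologicalClosure _
  -- Convolution with a character yields a multiple of a character, zero outside the spectrum of
  -- `f`; density of the characters' span in `C(G)` extends this to all continuous `k`.
  have hconv : ∀ k, convLp hp k f ∈ W := by
    let Λ : C(G, ℂ) →L[ℂ] Lp ℂ p (haarProb G) := (convLp hp).flip f
    have h1 : Submodule.span ℂ (charC '' ((⊤ : Subgroup (PontryaginDual G)) : Set _)) ≤
        W.comap (Λ : C(G, ℂ) →ₗ[ℂ] Lp ℂ p (haarProb G)) := by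
      rw [Submodule.span_le]
      rintro _ ⟨γ, -, rfl⟩
      change convLp hp (charC γ) f ∈ W
      rw [← inv_inv γ, convLp_charC]
      by_cases h : fourierCoeffAt p γ⁻¹ f = 0
      · rw [h, zero_smul]
        exact zero_mem _
      · exact W.smul_mem _ (Submodule.le_topologicalClosure _
          (Submodule.subset_span ⟨γ⁻¹, h, rfl⟩))
    have h2 := Submodule.topologicalClosure_minimal _ h1 (hWc.preimage Λ.continuous)
    rw [span_charC_topologicalClosure ⊤ fun x hx =>
      (exists_pontryaginDual_apply_ne_one hx).imp fun γ h => ⟨trivial, h⟩] at h2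
    exact fun k => h2 trivial
  have hcl : f ∈ closure (W : Set (Lp ℂ p (haarProb G))) := by
    -- Approximate identity: convolve with a nonnegative kernel of integral 1 which vanishes
    -- wherever translation moves `f` by at least `ε / 2`.
    refine Metric.mem_closure_iff.2 fun ε hε => ?_
    have hV : IsOpen {y : G | ‖translateLp p y f - f‖ < ε / 2} :=
      isOpen_lt ((continuous_translateLp hp f).sub continuous_const).norm continuous_const
    have h1V : (1 : G) ∈ {y : G | ‖translateLp p y f - f‖ < ε / 2} := by
      rw [Set.mem_ofPred_eq, translateLp_one, sub_self, norm_zero]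
      exact half_pos hε
    obtain ⟨φ, h0, h1, h01⟩ := exists_continuous_zero_one_of_isClosed hV.isClosed_compl
      (isClosed_singleton (x := (1 : G)))
      (Set.disjoint_singleton_right.2 fun h => h h1V)
    have hφi : Integrable φ (haarProb G) :=
      φ.continuous.integrable_of_hasCompactSupport (HasCompactSupport.of_compactSpace _)
    have hc : 0 < ∫ y, φ y ∂(haarProb G) :=
      φ.continuous.integral_pos_of_hasCompactSupport_nonneg_nonzero
        (HasCompactSupport.of_compactSpace _) (fun x => (h01 x).1) (x := 1)
        (by rw [h1 rfl]; exact one_ne_zero)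
    set c := ∫ y, φ y ∂(haarProb G) with hcdef
    let k : C(G, ℂ) := ⟨fun y => ((c⁻¹ * φ y : ℝ) : ℂ), by fun_prop⟩
    have hk : ∀ y, k y = ((c⁻¹ * φ y : ℝ) : ℂ) := fun y => rfl
    refine ⟨convLp hp k f, hconv k, ?_⟩
    have hk1 : ∫ y, k y ∂(haarProb G) = 1 := by
      simp_rw [hk]
      rw [integral_complex_ofReal, integral_const_mul, inv_mul_cancel₀ hc.ne',
        Complex.ofReal_one]
    have hki : Integrable (fun y => k y) (haarProb G) :=
      k.continuous.integrable_of_hasCompactSupport (HasCompactSupport.of_compactSpace _)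
    have h2 : convLp hp k f - f = ∫ y, k y • (translateLp p y f - f) ∂(haarProb G) := by
      simp_rw [smul_sub]
      rw [integral_sub (integrable_smul_translateLp hp k f) (hki.smul_const f),
        integral_smul_const, hk1, one_smul, convLp_apply]
    rw [dist_comm, dist_eq_norm, h2]
    have h3 : ‖∫ y, k y • (translateLp p y f - f) ∂(haarProb G)‖ ≤
        ∫ y, c⁻¹ * φ y * (ε / 2) ∂(haarProb G) := by
      refine norm_integral_le_of_norm_le ((hφi.const_mul _).mul_const _)
        (Filter.Eventually.of_forall fun y => ?_)
      have hnn : 0 ≤ c⁻¹ * φ y := mul_nonneg (inv_nonneg.2 hc.le) (h01 y).1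
      rw [norm_smul, hk, Complex.norm_real, Real.norm_of_nonneg hnn]
      by_cases hy : ‖translateLp p y f - f‖ < ε / 2
      · exact mul_le_mul_of_nonneg_left hy.le hnn
      · rw [h0 hy]
        simp
    refine h3.trans_lt ?_
    rw [integral_mul_const, integral_const_mul, inv_mul_cancel₀ hc.ne', one_mul]
    exact half_lt_self hε
  exact hWc.closure_subset hcl

/-- The approximating polynomials only use characters in the spectrum of `f`, so they stay inside
the Hardy space. -/
theorem hardy_le_closure_span (hp : p ≠ ∞) (E : Set (PontryaginDual G)) :
    hardy p E ≤ (Submodule.span ℂ (charLp p '' E)).topologicalClosure := fun f hf =>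
  Submodule.topologicalClosure_mono (Submodule.span_mono (Set.image_mono fun γ hγ => hf γ hγ))
    (mem_closure_span_charLp hp f)

/-- The inclusion of `L_p(G)` in `L_1(G)`. -/
noncomputable def toL1 (f : Lp ℂ p (haarProb G)) : Lp ℂ 1 (haarProb G) :=
  ((Lp.memLp f).mono_exponent Fact.out).toLp f

theorem coeFn_toL1 (f : Lp ℂ p (haarProb G)) : toL1 f =ᵐ[haarProb G] f :=
  MemLp.coeFn_toLp _

theorem fourierCoeffAt_congr {q : ℝ≥0∞} [Fact (1 ≤ q)] {f : Lp ℂ p (haarProb G)}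
    {g : Lp ℂ q (haarProb G)} (h : f =ᵐ[haarProb G] g) (γ : PontryaginDual G) :
    fourierCoeffAt p γ f = fourierCoeffAt q γ g :=
  integral_congr_ae (h.mono fun x hx => by simp only [hx])

/-- The uniqueness theorem for Fourier coefficients. -/
theorem Lp_eq_zero_of_fourierCoeffAt_eq_zero {f : Lp ℂ p (haarProb G)}
    (hf : ∀ γ, fourierCoeffAt p γ f = 0) : f = 0 := by
  -- Density fails in `L_∞` in general, so the argument takes place in `L_1`.
  have h1 := mem_closure_span_charLp ENNReal.one_ne_top (toL1 f)
  have h2 : {γ | fourierCoeffAt 1 γ (toL1 f) ≠ 0} = ∅ :=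
    Set.eq_empty_of_forall_notMem fun γ h => h
      ((fourierCoeffAt_congr (coeFn_toL1 f) γ).trans (hf γ))
  rw [h2, Set.image_empty, Submodule.span_empty] at h1
  have h3 : toL1 f = 0 := by
    have h4 : toL1 f ∈ closure ({0} : Set (Lp ℂ 1 (haarProb G))) := h1
    rwa [closure_singleton] at h4
  refine Lp.ext ((coeFn_toL1 f).symm.trans ?_)
  rw [h3]
  exact (Lp.coeFn_zero ℂ 1 _).trans (Lp.coeFn_zero ℂ p _).symm

theorem Lp_ext_fourierCoeffAt {f g : Lp ℂ p (haarProb G)}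
    (hfg : ∀ γ, fourierCoeffAt p γ f = fourierCoeffAt p γ g) : f = g :=
  sub_eq_zero.1 (Lp_eq_zero_of_fourierCoeffAt_eq_zero fun γ => by
    rw [map_sub, hfg, sub_self])

/-- A point-separating group of characters contains all characters. -/
theorem mem_of_separatesPoints (X : Subgroup (PontryaginDual G))
    (hX : ∀ x : G, x ≠ 1 → ∃ γ ∈ X, γ x ≠ 1) (η : PontryaginDual G) : η ∈ X := by
  by_contra hη
  -- By orthogonality the coefficient at `η ∉ X` vanishes on `X`, hence by density on `C(G)`; but it
  -- is 1 at `η`.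
  let Λ : C(G, ℂ) →ₗ[ℂ] ℂ := (fourierCoeffAt 1 η).comp
    (ContinuousMap.toLp 1 (haarProb G) ℂ).toLinearMap
  have hΛ : Continuous Λ :=
    (continuous_fourierCoeffAt 1 η).comp (ContinuousMap.toLp 1 (haarProb G) ℂ).continuous
  have h1 : Submodule.span ℂ (charC '' (X : Set (PontryaginDual G))) ≤ LinearMap.ker Λ := by
    rw [Submodule.span_le]
    rintro _ ⟨γ, hγ, rfl⟩
    exact fourierCoeffAt_charLp_of_ne 1 fun h => hη (h ▸ hγ)
  have h2 := Submodule.topologicalClosure_minimal _ h1 (isClosed_singleton.preimage hΛ)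
  rw [span_charC_topologicalClosure X hX] at h2
  have h3 : fourierCoeffAt 1 η (charLp 1 η) = 0 := h2 (x := charC η) trivial
  rw [fourierCoeffAt_charLp_self] at h3
  exact one_ne_zero h3

end Density

/-! ### Transference between compact groups -/

section Transference

set_option linter.unusedSectionVars false

/-- The characters of the dual of a discrete group given by evaluation. -/
noncomputable def evalCharHom (A : Type*) [AddCommGroup A] :
    DiscreteCopy A →* PontryaginDual (DiscreteDual A) where
  toFun a := evalChar (Multiplicative.toAdd (show Multiplicative A from a))
  map_one' := PontryaginDual.ext fun χ => map_one χ
  map_mul' a b := PontryaginDual.ext fun χ => map_mul χ a b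

theorem exists_evalCharHom_ne_one {A : Type*} [AddCommGroup A] (χ : DiscreteDual A) (h : χ ≠ 1) :
    ∃ γ ∈ (evalCharHom A).range, γ χ ≠ 1 := by
  by_contra! H
  exact h (PontryaginDual.ext fun a => H _ ⟨a, rfl⟩)

/-- The evaluations form a point-separating group of characters, hence exhaust the dual: Pontryagin
duality for discrete groups. -/
theorem exists_eq_evalChar {A : Type*} [AddCommGroup A] (γ : PontryaginDual (DiscreteDual A)) :
    ∃ a, γ = evalChar a := by
  obtain ⟨a, ha⟩ := mem_of_separatesPoints (evalCharHom A).range exists_evalCharHom_ne_one γ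
  exact ⟨_, ha.symm⟩

variable {G : Type*} [CommGroup G] [TopologicalSpace G] [IsTopologicalGroup G]
  [CompactSpace G] [T2Space G] [MeasurableSpace G] [BorelSpace G]
  {A : Type*} [AddCommGroup A]

/-- A homomorphism from a discrete group to the dual of `G`, dualized. -/
noncomputable def dualMap (ι : DiscreteCopy A →* PontryaginDual G) (x : G) : DiscreteDual A :=
  ({ toFun := fun a => ι a x
     map_one' := by rw [map_one]; rfl
     map_mul' := fun a b => by rw [map_mul]; rfl
     continuous_toFun := continuous_of_discreteTopology } : DiscreteCopy A →ₜ* Circle)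

theorem continuous_dualMap (ι : DiscreteCopy A →* PontryaginDual G) : Continuous (dualMap ι) :=
  ContinuousMonoidHom.continuous_of_continuous_uncurry
    (dualMap ι : G → DiscreteCopy A →ₜ* Circle) (continuous_prod_of_discrete_right.2 fun a => map_continuous (ι a))

/-- Both measures integrate the trivial character to 1 and, by injectivity of `ι`, every other one
to 0. Characters span a dense subspace of the continuous functions, and regular measures are
determined by the integrals of these. -/
theorem measurePreserving_dualMap {ι : DiscreteCopy A →* PontryaginDual G}
    (hι : Function.Injective ι) :
    MeasurePreserving (dualMap ι) (haarProb G) (haarProb (DiscreteDual A)) := by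
  have hc := continuous_dualMap ι
  refine ⟨hc.measurable, ?_⟩
  have : IsProbabilityMeasure ((haarProb G).map (dualMap ι)) :=
    Measure.isProbabilityMeasure_map hc.aemeasurable
  have : ((haarProb G).map (dualMap ι)).InnerRegular :=
    Measure.InnerRegular.map_of_continuous hc
  let I (μ : Measure (DiscreteDual A)) [IsProbabilityMeasure μ] : C(DiscreteDual A, ℂ) →L[ℂ] ℂ :=
    LinearMap.mkContinuous
      { toFun := fun f => ∫ x, f x ∂μ
        map_add' := fun f g => integral_add
          (f.continuous.integrable_of_hasCompactSupport (HasCompactSupport.of_compactSpace _))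
          (g.continuous.integrable_of_hasCompactSupport (HasCompactSupport.of_compactSpace _))
        map_smul' := fun c f => integral_smul c f } 1
      fun f => (norm_integral_le_of_norm_le_const
        (Filter.Eventually.of_forall fun y => f.norm_coe_le_norm y)).trans (by simp)
  have hI : I ((haarProb G).map (dualMap ι)) = I (haarProb (DiscreteDual A)) := by
    have h1 : Submodule.span ℂ (charC '' ((evalCharHom A).range : Set _)) ≤
        LinearMap.eqLocus (I ((haarProb G).map (dualMap ι))).toLinearMap
          (I (haarProb (DiscreteDual A))).toLinearMap := by
      rw [Submodule.span_le]
      rintro _ ⟨_, ⟨a, rfl⟩, rfl⟩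
      change ∫ x, charC (evalCharHom A a) x ∂((haarProb G).map (dualMap ι)) =
        ∫ x, charC (evalCharHom A a) x ∂(haarProb (DiscreteDual A))
      rw [integral_map hc.aemeasurable (charC _).continuous.aestronglyMeasurable]
      by_cases ha : a = 1
      · rw [ha, map_one]
        simp [charC_apply]
      · have h2 : ι a ≠ 1 := fun h => ha (hι (h.trans (map_one ι).symm))
        have h3 : evalCharHom A a ≠ 1 := fun h => h2 (PontryaginDual.ext fun x =>
          DFunLike.congr_fun h (dualMap ι x))
        exact (integral_char_eq_zero h2).trans (integral_char_eq_zero h3).symm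
    have h2 := Submodule.topologicalClosure_minimal _ h1
      (isClosed_eq (I _).continuous (I _).continuous)
    rw [span_charC_topologicalClosure _ exists_evalCharHom_ne_one] at h2
    exact ContinuousLinearMap.ext fun f => h2 trivial
  refine Measure.ext_of_integral_eq_on_compactlySupported fun f => ?_
  let F : C(DiscreteDual A, ℂ) := ⟨fun x => (f x : ℂ), by fun_prop⟩
  have h1 := DFunLike.congr_fun hI F
  have h2 : (∫ x, (f x : ℂ) ∂((haarProb G).map (dualMap ι))) =
    ∫ x, (f x : ℂ) ∂(haarProb (DiscreteDual A)) := h1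
  rw [integral_complex_ofReal, integral_complex_ofReal] at h2
  exact Complex.ofReal_injective h2

variable (p : ℝ≥0∞) [Fact (1 ≤ p)]

/-- Composition with `dualMap`. -/
noncomputable def pullLp {ι : DiscreteCopy A →* PontryaginDual G} (hι : Function.Injective ι) :
    Lp ℂ p (haarProb (DiscreteDual A)) →ₗᵢ[ℂ] Lp ℂ p (haarProb G) :=
  Lp.compMeasurePreservingₗᵢ ℂ _ (measurePreserving_dualMap hι)

variable {p} {ι : DiscreteCopy A →* PontryaginDual G} (hι : Function.Injective ι)

theorem coeFn_pullLp (f : Lp ℂ p (haarProb (DiscreteDual A))) :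
    pullLp p hι f =ᵐ[haarProb G] f ∘ dualMap ι :=
  Lp.coeFn_compMeasurePreserving f (measurePreserving_dualMap hι)

theorem pullLp_charLp (a : DiscreteCopy A) :
    pullLp p hι (charLp p (evalCharHom A a)) = charLp p (ι a) := rfl

theorem fourierCoeffAt_pullLp (a : DiscreteCopy A) (f : Lp ℂ p (haarProb (DiscreteDual A))) :
    fourierCoeffAt p (ι a) (pullLp p hι f) = fourierCoeffAt p (evalCharHom A a) f := by
  have hπ := measurePreserving_dualMap hι
  have h1 := integrable_mul_char p f (evalCharHom A a)
  have h2 : ∀ g : DiscreteDual A → ℂ, AEStronglyMeasurable g (haarProb (DiscreteDual A)) →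
      ∫ x, g (dualMap ι x) ∂(haarProb G) = ∫ y, g y ∂(haarProb (DiscreteDual A)) := by
    intro g hg
    rw [← hπ.map_eq] at hg ⊢
    exact (integral_map hπ.measurable.aemeasurable hg).symm
  refine Eq.trans (integral_congr_ae ?_) (h2 _ h1.aestronglyMeasurable)
  filter_upwards [coeFn_pullLp hι f] with x hx
  rw [hx]
  rfl

theorem toL1_pullLp (f : Lp ℂ p (haarProb (DiscreteDual A))) :
    toL1 (pullLp p hι f) = pullLp 1 hι (toL1 f) := by
  refine Lp.ext ((coeFn_toL1 _).trans ((coeFn_pullLp hι f).trans ?_))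
  refine Filter.EventuallyEq.trans ?_ (coeFn_pullLp hι (toL1 f)).symm
  exact (measurePreserving_dualMap hι).quasiMeasurePreserving.ae_eq_comp (coeFn_toL1 f).symm

theorem toL1_mem_hardy_iff {H : Type*} [CommGroup H] [TopologicalSpace H] [IsTopologicalGroup H]
    [CompactSpace H] [T2Space H] [MeasurableSpace H] [BorelSpace H] {E : Set (PontryaginDual H)}
    {f : Lp ℂ p (haarProb H)} : toL1 f ∈ hardy 1 E ↔ f ∈ hardy p E := by
  refine forall_congr' fun γ => ?_
  rw [fourierCoeffAt_congr (coeFn_toL1 f) γ]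

/-- Characters go to characters, and on each side those in the spectrum span densely; the image is
closed because the map is isometric. -/
theorem map_pullLp_hardy_one (S : Set (DiscreteCopy A)) :
    (hardy 1 (evalCharHom A '' S)).map (pullLp 1 hι).toLinearMap = hardy 1 (ι '' S) := by
  apply le_antisymm
  · refine (Submodule.map_mono (hardy_le_closure_span ENNReal.one_ne_top _)).trans ?_
    rw [Submodule.map_le_iff_le_comap]
    refine Submodule.topologicalClosure_minimal _ ?_
      ((isClosed_hardy 1 (ι '' S)).preimage (pullLp 1 hι).continuous)
    rw [Submodule.span_le]
    rintro _ ⟨_, ⟨a, ha, rfl⟩, rfl⟩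
    exact charLp_mem_hardy 1 ⟨a, ha, rfl⟩
  · refine (hardy_le_closure_span ENNReal.one_ne_top _).trans ?_
    refine Submodule.topologicalClosure_minimal _ ?_
      ((pullLp 1 hι).isometry.isClosedEmbedding.isClosedMap _ (isClosed_hardy 1 _))
    rw [Submodule.span_le]
    rintro _ ⟨_, ⟨a, ha, rfl⟩, rfl⟩
    exact ⟨_, charLp_mem_hardy 1 ⟨a, ha, rfl⟩, pullLp_charLp hι a⟩

/-- Reduction to `p = 1`, which makes `p = ∞` accessible although polynomials need not be dense
there. -/
theorem map_pullLp_hardy (S : Set (DiscreteCopy A)) :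
    (hardy p (evalCharHom A '' S)).map (pullLp p hι).toLinearMap = hardy p (ι '' S) := by
  have h1 := map_pullLp_hardy_one hι S
  apply le_antisymm
  · rintro _ ⟨f, hf, rfl⟩
    refine toL1_mem_hardy_iff.1 (h1 ▸ ?_)
    exact ⟨toL1 f, toL1_mem_hardy_iff.2 hf, (toL1_pullLp hι f).symm⟩
  · intro g hg
    obtain ⟨f, hf, hfg⟩ : toL1 g ∈ (hardy 1 (evalCharHom A '' S)).map (pullLp 1 hι).toLinearMap :=
      h1 ▸ toL1_mem_hardy_iff.2 hg
    have hπ := measurePreserving_dualMap hι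
    have hae : f ∘ dualMap ι =ᵐ[haarProb G] g :=
      (coeFn_pullLp hι f).symm.trans ((Filter.EventuallyEq.of_eq
        (congrArg (fun h : Lp ℂ 1 (haarProb G) => (h : G → ℂ)) hfg)).trans (coeFn_toL1 g))
    -- The `L_1`-preimage `f` has the same `p`-norm as `g`, as `f ∘ dualMap ι = g` almost everywhere
    -- and `dualMap ι` preserves the measure.
    have hmem : MemLp f p (haarProb (DiscreteDual A)) := by
      refine ⟨Lp.aestronglyMeasurable f, ?_⟩
      rw [← eLpNorm_comp_measurePreserving (Lp.aestronglyMeasurable f) hπ, eLpNorm_congr_ae hae]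
      exact Lp.eLpNorm_lt_top g
    refine ⟨hmem.toLp f, toL1_mem_hardy_iff.1 ?_, Lp.ext ?_⟩
    · have : toL1 (hmem.toLp f) = f := Lp.ext ((coeFn_toL1 _).trans hmem.coeFn_toLp)
      rwa [this]
    · refine (coeFn_pullLp hι _).trans (Filter.EventuallyEq.trans ?_ hae)
      exact hπ.quasiMeasurePreserving.ae_eq_comp hmem.coeFn_toLp

/-- The Hardy space with spectrum `ι '' S` does not depend on the group, but only on the
discrete group `A` and its subset `S`. -/
theorem exists_hardy_equiv (hι : Function.Injective ι) {I : Type*} (a : I → A) (χ : I → PontryaginDual G)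
    (hχ : ∀ i, ι (DiscreteCopy.of (a i)) = χ i) {E : Set (PontryaginDual G)}
    (hE : E = Set.range χ) :
    ∃ e : hardy p (Set.range fun i => evalChar (a i)) ≃ₗᵢ[ℂ] hardy p E,
      ∀ F i, fourierCoeffAt p (χ i) (e F) = fourierCoeffAt p (evalChar (a i)) F := by
  subst hE
  have h1 := map_pullLp_hardy (p := p) hι (Set.range fun i => DiscreteCopy.of (a i))
  have h2 : evalCharHom A '' (Set.range fun i => DiscreteCopy.of (a i)) =
      Set.range fun i => evalChar (a i) := (Set.range_comp _ _).symm
  have h3 : ι '' (Set.range fun i => DiscreteCopy.of (a i)) = Set.range χ := by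
    rw [← Set.range_comp]
    exact congrArg Set.range (funext hχ)
  rw [h2, h3] at h1
  let T : hardy p (Set.range fun i => evalChar (a i)) →ₗᵢ[ℂ] hardy p (Set.range χ) :=
    { toLinearMap := (pullLp p hι).toLinearMap.restrict fun f hf =>
        h1 ▸ Submodule.mem_map_of_mem hf
      norm_map' := fun f => (pullLp p hι).norm_map f }
  refine ⟨LinearIsometryEquiv.ofSurjective T ?_, fun F i => ?_⟩
  · rintro ⟨g, hg⟩
    rw [← h1] at hg
    obtain ⟨f, hf, rfl⟩ := hg
    exact ⟨⟨f, hf⟩, rfl⟩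
  · rw [← hχ]
    exact fourierCoeffAt_pullLp hι _ _

end Transference

/-! ### Characters indexed by the group generated by the rows of a Bohr matrix -/

section Rows

set_option linter.unusedSectionVars false

/-- `exists_hardy_equiv` for an additively written embedding of `A` into the dual of `G`. -/
theorem exists_hardy_equiv_of_add {G : Type*} [CommGroup G] [TopologicalSpace G]
    [IsTopologicalGroup G] [CompactSpace G] [T2Space G] [MeasurableSpace G] [BorelSpace G]
    {A : Type*} [AddCommGroup A] (p : ℝ≥0∞) [Fact (1 ≤ p)] {f : A → PontryaginDual G}
    (hf : ∀ a b, f (a + b) = f a * f b) (hinj : Function.Injective f) {I : Type*} (a : I → A)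
    {E : Set (PontryaginDual G)} (hE : E = Set.range fun i => f (a i)) :
    ∃ e : hardy p (Set.range fun i => evalChar (a i)) ≃ₗᵢ[ℂ] hardy p E,
      ∀ F i, fourierCoeffAt p (f (a i)) (e F) = fourierCoeffAt p (evalChar (a i)) F :=
  exists_hardy_equiv (ι := MonoidHom.mk' (M := DiscreteCopy A) f hf) hinj a _ (fun _ => rfl) hE

theorem eq_of_forall_circleExp_eq {x y : ℝ}
    (h : ∀ t, Circle.exp (-(x * t)) = Circle.exp (-(y * t))) : x = y := by
  by_contra hxy
  have hxy' : y - x ≠ 0 := sub_ne_zero.2 (Ne.symm hxy)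
  -- At this `t` the two values differ by the factor `exp(iπ) = -1`.
  have h1 := h (Real.pi / (y - x))
  have h2 : Circle.exp Real.pi = 1 := by
    have h3 : Real.pi = -(x * (Real.pi / (y - x))) - -(y * (Real.pi / (y - x))) := by
      field_simp
      ring
    rw [h3, Circle.exp_sub, h1, div_self']
  have h4 := congrArg (fun z : Circle => (z : ℂ)) h2
  simp only [Circle.coe_exp, Complex.exp_pi_mul_I, Circle.coe_one] at h4
  norm_num at h4

/-! ### Characters extending `t ↦ exp(-ixt)`, and the Bohr compactification. -/

section Extends

variable {G : Type*} [CommGroup G] [TopologicalSpace G] {β : ℝ → G}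

theorem Extends.add {x y : ℝ} {γ η : PontryaginDual G} (hγ : Extends β x γ)
    (hη : Extends β y η) : Extends β (x + y) (γ * η) := fun t => by
  rw [PontryaginDual.mul_apply', hγ, hη, ← Circle.exp_add]
  congr 1
  ring

theorem Extends.neg {x : ℝ} {γ : PontryaginDual G} (hγ : Extends β x γ) :
    Extends β (-x) γ⁻¹ := fun t => by
  rw [PontryaginDual.inv_apply', hγ, ← Circle.exp_neg]
  congr 1
  ring

theorem extends_zero : Extends β 0 1 := fun t => by simp

theorem Extends.unique (hβ : IsDirichletGroup β) {x : ℝ} {γ η : PontryaginDual G}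
    (hγ : Extends β x γ) (hη : Extends β x η) : γ = η :=
  DFunLike.coe_injective (hβ.denseRange.equalizer (map_continuous γ) (map_continuous η)
    (funext fun t => (hγ t).trans (hη t).symm))

theorem Extends.eq {x y : ℝ} {γ : PontryaginDual G} (hγ : Extends β x γ)
    (hγ' : Extends β y γ) : x = y :=
  eq_of_forall_circleExp_eq fun t => (hγ t).symm.trans (hγ' t)

end Extends

theorem extends_bohrEmbedding_evalChar (x : ℝ) : Extends bohrEmbedding x (evalChar x) := fun t => by
  change Circle.exp (-(t * x)) = _
  rw [mul_comm]

/-- Every character of the Bohr compactification is an evaluation, and its frequency is determined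
along the embedding. -/
theorem extends_bohrEmbedding_iff {x : ℝ} {γ : PontryaginDual BohrR} :
    Extends bohrEmbedding x γ ↔ γ = evalChar x := by
  constructor
  · intro h
    obtain ⟨y, rfl⟩ := exists_eq_evalChar γ
    rw [h.eq (extends_bohrEmbedding_evalChar y)]
  · rintro rfl
    exact extends_bohrEmbedding_evalChar x

theorem evalChar_real_injective : Function.Injective (evalChar : ℝ → PontryaginDual BohrR) :=
  fun x y h => (extends_bohrEmbedding_evalChar x).eq (h ▸ extends_bohrEmbedding_evalChar y)

theorem evalChar_add {A : Type*} [AddCommGroup A] (a b : A) :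
    evalChar (a + b) = evalChar a * evalChar b :=
  map_mul (evalCharHom A) (DiscreteCopy.of a) (DiscreteCopy.of b)

/-! ### Embeddings of groups of sequences into the duals of powers. -/

variable {N : ℕ∞}

theorem rowChar_apply (r : Ix N →₀ ℚ) (χ : QDualPow N) :
    rowChar r χ = r.prod fun k q => evalChar q (χ k) := rfl

theorem rowChar_add (r s : Ix N →₀ ℚ) : rowChar (r + s) = rowChar r * rowChar s :=
  PontryaginDual.ext fun χ => by
    rw [PontryaginDual.mul_apply', rowChar_apply, rowChar_apply, rowChar_apply]
    exact Finsupp.prod_add_index' (fun k => map_one (χ k)) fun k a b => map_mul (χ k) _ _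

/-- The character `q ↦ exp(-itq)` of the discrete rationals. -/
noncomputable def ratChar (t : ℝ) : DiscreteDual ℚ :=
  ({ toFun := fun q => bohrEmbedding t
        (DiscreteCopy.of ((Multiplicative.toAdd (show Multiplicative ℚ from q) : ℚ) : ℝ))
     map_one' := by
      change Circle.exp (-(t * ((0 : ℚ) : ℝ))) = 1
      simp
     map_mul' := by
      have h : ∀ q r : ℚ, Circle.exp (-(t * ((q + r : ℚ) : ℝ))) =
          Circle.exp (-(t * q)) * Circle.exp (-(t * r)) := fun q r => by
        rw [← Circle.exp_add]
        congr 1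
        push_cast
        ring
      exact h
     continuous_toFun := continuous_of_discreteTopology } : DiscreteCopy ℚ →ₜ* Circle)

theorem evalChar_ratChar (t : ℝ) (q : ℚ) : evalChar q (ratChar t) = Circle.exp (-(q * t)) := by
  rw [mul_comm]
  rfl

theorem rowChar_mulSingle (r : Ix N →₀ ℚ) (k : Ix N) (χ : DiscreteDual ℚ) :
    rowChar r (Pi.mulSingle k χ) = evalChar (r k) χ := by
  rw [rowChar_apply, Finsupp.prod, Finset.prod_eq_single k]
  · rw [Pi.mulSingle_eq_same]
  · intro j _ hj
    rw [Pi.mulSingle_eq_of_ne hj, map_one]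
  · intro hk
    rw [Finsupp.notMem_support_iff.1 hk]
    rw [Pi.mulSingle_eq_same]
    exact map_one χ

theorem rowChar_injective : Function.Injective (rowChar : (Ix N →₀ ℚ) → _) := fun r s h =>
  Finsupp.ext fun k => Rat.cast_injective (eq_of_forall_circleExp_eq fun t => by
    rw [← evalChar_ratChar, ← evalChar_ratChar, ← rowChar_mulSingle, h, rowChar_mulSingle])

theorem monomialChar_apply (α : Ix N →₀ ℤ) (z : Torus N) :
    monomialChar α z = α.prod fun k n => z k ^ n := rfl

theorem monomialChar_add (α β : Ix N →₀ ℤ) :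
    monomialChar (α + β) = monomialChar α * monomialChar β :=
  PontryaginDual.ext fun z => by
    rw [PontryaginDual.mul_apply', monomialChar_apply, monomialChar_apply, monomialChar_apply]
    exact Finsupp.prod_add_index' (fun k => zpow_zero _) fun k a b => zpow_add _ _ _

theorem monomialChar_mulSingle (α : Ix N →₀ ℤ) (k : Ix N) (z : Circle) :
    monomialChar α (Pi.mulSingle k z) = z ^ α k := by
  rw [monomialChar_apply, Finsupp.prod, Finset.prod_eq_single k]
  · rw [Pi.mulSingle_eq_same]
  · intro j _ hj
    rw [Pi.mulSingle_eq_of_ne hj, one_zpow]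
  · intro hk
    rw [Finsupp.notMem_support_iff.1 hk, zpow_zero]

theorem monomialChar_injective : Function.Injective (monomialChar : (Ix N →₀ ℤ) → _) :=
  fun α β h => Finsupp.ext fun k => Int.cast_injective (α := ℝ) (eq_of_forall_circleExp_eq
    fun t => by
      have h1 := DFunLike.congr_fun h (Pi.mulSingle k (Circle.exp (-t)))
      rw [monomialChar_mulSingle, monomialChar_mulSingle, ← Circle.exp_zsmul,
        ← Circle.exp_zsmul] at h1
      simpa using h1)

/-! ### The row group as common model of the Hardy spaces. -/

/-- The group generated by the rows of `R`. -/
abbrev RowGroup (R : ℕ → (Ix N →₀ ℚ)) : Type := AddSubgroup.closure (Set.range R)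

/-- The rows of `R` as elements of the group they generate. -/
def rowOf (R : ℕ → (Ix N →₀ ℚ)) (n : ℕ) : RowGroup R := ⟨R n, AddSubgroup.subset_closure ⟨n, rfl⟩⟩

variable (p : ℝ≥0∞) [Fact (1 ≤ p)] (R : ℕ → (Ix N →₀ ℚ))

/-- The Hardy space with spectrum in the rows of `R` on the dual of the group they generate. -/
noncomputable abbrev hardyRow : Submodule ℂ (Lp ℂ p (haarProb (DiscreteDual (RowGroup R)))) :=
  hardy p (Set.range fun n => evalChar (rowOf R n))

theorem exists_equiv_hardyQDual : ∃ e : hardyRow p R ≃ₗᵢ[ℂ] hardyQDual p R,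
    ∀ F n, fourierCoeffAt p (rowChar (R n)) (e F) = fourierCoeffAt p (evalChar (rowOf R n)) F :=
  exists_hardy_equiv_of_add p (f := fun r : RowGroup R => rowChar (r : Ix N →₀ ℚ))
    (fun _ _ => rowChar_add _ _) (rowChar_injective.comp Subtype.val_injective) (rowOf R) rfl

variable {R} {lam : ℕ → ℝ} {B : Ix N → ℝ}

theorem IsDecomposition.linearCombination_eq (h : IsDecomposition lam R B) (n : ℕ) :
    Finsupp.linearCombination ℚ B (R n) = lam n := by
  rw [h.2, Finsupp.linearCombination_apply]
  exact Finsupp.sum_congr fun k _ => Rat.smul_def _ _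

/-- The point where linear independence of `B` enters: distinct elements of the row group have
distinct frequencies. -/
theorem IsDecomposition.linearCombination_injective (h : IsDecomposition lam R B) :
    Function.Injective fun r : RowGroup R => Finsupp.linearCombination ℚ B (r : Ix N →₀ ℚ) :=
  Function.Injective.comp (g := Finsupp.linearCombination ℚ B) h.1 Subtype.val_injective

theorem exists_equiv_hardyBohr (h : IsDecomposition lam R B) :
    ∃ e : hardyRow p R ≃ₗᵢ[ℂ] hardyLambda p lam bohrEmbedding,
      ∀ F n, fourierCoeffAt p (evalChar (lam n)) (e F) =
        fourierCoeffAt p (evalChar (rowOf R n)) F := by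
  have hE : {γ | ∃ n, Extends bohrEmbedding (lam n) γ} = Set.range fun n =>
      evalChar (Finsupp.linearCombination ℚ B (rowOf R n : Ix N →₀ ℚ)) := by
    ext γ
    refine exists_congr fun n => ?_
    rw [extends_bohrEmbedding_iff, ← h.linearCombination_eq]
    exact eq_comm
  obtain ⟨e, he⟩ := exists_hardy_equiv_of_add p (f := fun r : RowGroup R =>
      evalChar (Finsupp.linearCombination ℚ B (r : Ix N →₀ ℚ)))
    (fun r s => by rw [← evalChar_add, AddSubgroup.coe_add, map_add])
    (evalChar_real_injective.comp h.linearCombination_injective) (rowOf R) hE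
  refine ⟨e, fun F n => ?_⟩
  rw [← he F n, ← h.linearCombination_eq]
  rfl

/-- The frequencies whose exponentials extend along `β` form a group containing all `lam n`, hence
all those coming from the row group. Dense range makes the extension unique, so choosing it is
additive; distinct frequencies give distinct characters. -/
theorem exists_equiv_hardyLambda {G : Type*} [CommGroup G] [TopologicalSpace G]
    [IsTopologicalGroup G] [CompactSpace G] [T2Space G] [MeasurableSpace G] [BorelSpace G]
    {β : ℝ → G} (hβ : IsLambdaDirichletGroup lam β) (h : IsDecomposition lam R B) :
    ∃ e : hardyRow p R ≃ₗᵢ[ℂ] hardyLambda p lam β,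
      ∀ F n, fourierCoeffAt p (hβ.char n) (e F) =
        fourierCoeffAt p (evalChar (rowOf R n)) F := by
  have hex : ∀ r : RowGroup R, ∃ γ : PontryaginDual G,
      Extends β (Finsupp.linearCombination ℚ B (r : Ix N →₀ ℚ)) γ := by
    rintro ⟨r, hr⟩
    induction hr using AddSubgroup.closure_induction with
    | mem r hr =>
      obtain ⟨n, rfl⟩ := hr
      exact ⟨hβ.char n, by rw [h.linearCombination_eq]; exact hβ.char_spec n⟩
    | zero => exact ⟨1, by rw [map_zero]; exact extends_zero⟩
    | add r s _ _ hr hs =>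
      obtain ⟨γ, hγ⟩ := hr
      obtain ⟨η, hη⟩ := hs
      exact ⟨γ * η, by rw [map_add]; exact hγ.add hη⟩
    | neg r _ hr =>
      obtain ⟨γ, hγ⟩ := hr
      exact ⟨γ⁻¹, by rw [map_neg]; exact hγ.neg⟩
  choose f hf using hex
  have hfn : ∀ n, f (rowOf R n) = hβ.char n := fun n =>
    Extends.unique hβ.toIsDirichletGroup (by rw [← h.linearCombination_eq]; exact hf _)
      (hβ.char_spec n)
  have hE : {γ | ∃ n, Extends β (lam n) γ} = Set.range fun n => f (rowOf R n) := by
    ext γ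
    refine exists_congr fun n => ⟨fun hγ => ?_, fun hγ => ?_⟩
    · exact (hfn n).trans ((hβ.char_spec n).unique hβ.toIsDirichletGroup hγ)
    · rw [← hγ]
      change Extends β (lam n) (f (rowOf R n))
      rw [hfn]
      exact hβ.char_spec n
  obtain ⟨e, he⟩ := exists_hardy_equiv_of_add p (f := f)
    (fun r s => (hf (r + s)).unique hβ.toIsDirichletGroup (by
      rw [AddSubgroup.coe_add, map_add]
      exact (hf r).add (hf s)))
    (fun r s hrs => h.linearCombination_injective ((hf r).eq (hrs ▸ hf s))) (rowOf R) hE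
  refine ⟨e, fun F n => ?_⟩
  rw [← he F n, hfn]

/-! ### Integer matrices and tori. -/

/-- The integer sequence with the entries of `r`, placed along `j`. -/
noncomputable def intRow {L : ℕ∞} (j : Ix N ↪ Ix L) (r : Ix N →₀ ℚ) : Ix L →₀ ℤ :=
  (r.mapRange Rat.num Rat.num_zero).embDomain j

theorem IsRow.mapRange_num {n : ℕ} {α : Ix N →₀ ℤ} (h : IsRow R n α) :
    (R n).mapRange Rat.num Rat.num_zero = α :=
  Finsupp.ext fun k => by rw [Finsupp.mapRange_apply, h k, Rat.num_intCast]

theorem IsIntegerMatrix.exists_isRow (hR : IsIntegerMatrix R) (n : ℕ) : ∃ α, IsRow R n α :=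
  ⟨(R n).mapRange Rat.num Rat.num_zero, fun k => by
    obtain ⟨a, ha⟩ := hR n k
    rw [Finsupp.mapRange_apply, ha, Rat.num_intCast]⟩

/-- Integrality passes from the rows to the group they generate; there `Rat.num` loses nothing and
is additive. -/
theorem IsIntegerMatrix.num_rowGroup (hR : IsIntegerMatrix R) (r : RowGroup R) (k : Ix N) :
    (((r : Ix N →₀ ℚ) k).num : ℚ) = (r : Ix N →₀ ℚ) k := by
  obtain ⟨r, hr⟩ := r
  suffices ∃ a : ℤ, r k = a by
    obtain ⟨a, ha⟩ := this
    change ((r k).num : ℚ) = r k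
    rw [ha, Rat.num_intCast]
  induction hr using AddSubgroup.closure_induction with
  | mem r hr =>
    obtain ⟨n, rfl⟩ := hr
    exact hR n k
  | zero => exact ⟨0, by simp⟩
  | add r s _ _ hr hs =>
    obtain ⟨a, ha⟩ := hr
    obtain ⟨b, hb⟩ := hs
    exact ⟨a + b, by simp [ha, hb]⟩
  | neg r _ hr =>
    obtain ⟨a, ha⟩ := hr
    exact ⟨-a, by simp [ha]⟩

/-- The embedding `j` serves two cases: the identity for `𝕋^N`, and the inclusion into the infinite
torus for ordinary Dirichlet series. -/
theorem exists_equiv_hardy_torus (hR : IsIntegerMatrix R) {L : ℕ∞} (j : Ix N ↪ Ix L)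
    {E : Set (PontryaginDual (Torus L))}
    (hE : E = Set.range fun n => monomialChar (intRow j (R n))) :
    ∃ e : hardyRow p R ≃ₗᵢ[ℂ] hardy p E,
      ∀ F n, fourierCoeffAt p (monomialChar (intRow j (R n))) (e F) =
        fourierCoeffAt p (evalChar (rowOf R n)) F := by
  refine exists_hardy_equiv_of_add p
    (f := fun r : RowGroup R => monomialChar (intRow j (r : Ix N →₀ ℚ))) (fun r s => ?_)
    (fun r s hrs => ?_) (rowOf R) hE
  · rw [← monomialChar_add, intRow, intRow, intRow, ← Finsupp.embDomain_add]
    congr 2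
    ext k
    simp only [Finsupp.mapRange_apply, Finsupp.add_apply]
    refine Int.cast_injective (α := ℚ) ?_
    rw [Int.cast_add, hR.num_rowGroup, hR.num_rowGroup, hR.num_rowGroup]
    rfl
  · have h1 := Finsupp.embDomain_injective j (monomialChar_injective hrs)
    refine Subtype.ext (Finsupp.ext fun k => ?_)
    rw [← hR.num_rowGroup, ← hR.num_rowGroup s]
    exact congrArg _ (DFunLike.congr_fun h1 k)

end Rows

/-! ### Coefficient spaces, extremality of characters, and prime factorizations -/

section CoefficientSpaces

set_option linter.unusedSectionVars false

variable {G : Type*} [CommGroup G] [TopologicalSpace G] [IsTopologicalGroup G]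
  [CompactSpace G] [T2Space G] [MeasurableSpace G] [BorelSpace G]
  {p : ℝ≥0∞} [Fact (1 ≤ p)] {I : Type*} {E : Set (PontryaginDual G)} {χ : I → PontryaginDual G}

theorem hardy_ext (hE : E ⊆ Set.range χ) {f g : hardy p E}
    (h : ∀ i, fourierCoeffAt p (χ i) f = fourierCoeffAt p (χ i) g) : f = g := by
  refine Subtype.ext (Lp_ext_fourierCoeffAt fun γ => ?_)
  by_cases hγ : γ ∈ E
  · obtain ⟨i, rfl⟩ := hE hγ
    exact h i
  · rw [not_imp_comm.1 (f.2 γ) hγ, not_imp_comm.1 (g.2 γ) hγ]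

theorem coeffMap_injective (hE : E ⊆ Set.range χ) : Function.Injective (coeffMap p E χ) :=
  fun _ _ h => hardy_ext hE fun i => congrFun h i

theorem CoeffSpace.ext {D D' : CoeffSpace p E χ} (h : ∀ i, D.coeff i = D'.coeff i) : D = D' :=
  Subtype.ext (funext h)

/-- A Hardy space is isometric to its coefficient space. -/
noncomputable def coeffEquiv (hE : E ⊆ Set.range χ) : hardy p E ≃ₗᵢ[ℂ] CoeffSpace p E χ where
  toLinearEquiv := LinearEquiv.ofBijective (RangeSpace.mk (coeffMap p E χ))
    ⟨fun _ _ h => coeffMap_injective hE (congrArg RangeSpace.val h),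
      LinearMap.surjective_rangeRestrict _⟩
  norm_map' := RangeSpace.norm_mk_of_injective (coeffMap_injective hE)

theorem coeff_coeffEquiv (hE : E ⊆ Set.range χ) (f : hardy p E) (i : I) :
    (coeffEquiv hE f).coeff i = fourierCoeffAt p (χ i) f := rfl

theorem fourierCoeffAt_coeffEquiv_symm (hE : E ⊆ Set.range χ) (D : CoeffSpace p E χ) (i : I) :
    fourierCoeffAt p (χ i) ((coeffEquiv hE).symm D) = D.coeff i := by
  rw [← coeff_coeffEquiv hE, LinearIsometryEquiv.apply_symm_apply]

theorem norm_charLp_le (γ : PontryaginDual G) : ‖charLp p γ‖ ≤ 1 := by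
  have h := Lp.norm_le_of_ae_bound (f := charLp p γ) zero_le_one (by
    filter_upwards [ContinuousMap.coeFn_toLp (p := p) (𝕜 := ℂ) (haarProb G) (charC γ)] with x hx
    rw [charLp, hx, charC_apply, Circle.norm_coe])
  simpa [measureUnivNNReal] using h

/-- For `1 < p < ∞`, the character `γ` is the only function of norm at most one in `L_p(G)` whose
Fourier coefficient at `γ` is one. -/
theorem eq_charLp_of_norm_le_one (hp1 : 1 < p) (hp : p ≠ ∞) {f : Lp ℂ p (haarProb G)}
    (hf : ‖f‖ ≤ 1) {γ : PontryaginDual G} (hγ : fourierCoeffAt p γ f = 1) : f = charLp p γ := by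
  have hr : 1 < p.toReal := by
    rw [← ENNReal.toReal_one]
    exact (ENNReal.toReal_lt_toReal ENNReal.one_ne_top hp).2 hp1
  set r := p.toReal with hrdef
  have hp0 : p ≠ 0 := (zero_lt_one.trans hp1).ne'
  have hfi : Integrable f (haarProb G) := (Lp.memLp f).integrable Fact.out
  have hfr : Integrable (fun x => ‖f x‖ ^ r) (haarProb G) :=
    (Lp.memLp f).integrable_norm_rpow hp0 hp
  have h1 : 1 ≤ ∫ x, ‖f x‖ ∂(haarProb G) := by
    have h2 := norm_integral_le_integral_norm (μ := haarProb G)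
      fun x => f x * (starRingEnd ℂ) (γ x : ℂ)
    rw [← fourierCoeffAt_apply, hγ, norm_one] at h2
    simpa only [norm_mul, RCLike.norm_conj, Circle.norm_coe, mul_one] using h2
  have h2 : ∫ x, ‖f x‖ ^ r ∂(haarProb G) ≤ 1 := by
    have hnn : 0 ≤ ∫ x, ‖f x‖ ^ r ∂(haarProb G) := integral_nonneg fun x => by positivity
    rw [Lp.norm_def, (Lp.memLp f).eLpNorm_eq_integral_rpow_norm hp0 hp,
      ENNReal.toReal_ofReal (by positivity)] at hf
    by_contra! h
    exact absurd hf (not_le.2 (Real.one_lt_rpow h (by positivity)))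
  -- Strict Bernoulli inequality. Since `∫ ‖f‖ ≥ 1` and `∫ ‖f‖ ^ r ≤ 1`, this expression at `t = ‖f
  -- x‖` has integral at most 0, which forces `‖f x‖ = 1` almost everywhere.
  have hconv : ∀ t : ℝ, 0 ≤ t → t ≠ 1 → 0 < t ^ r - 1 - r * (t - 1) := fun t ht ht1 => by
    have := one_add_mul_self_lt_rpow_one_add (s := t - 1) (by linarith) (sub_ne_zero.2 ht1) hr
    rw [add_sub_cancel] at this
    linarith
  have hconv' : ∀ t : ℝ, 0 ≤ t → 0 ≤ t ^ r - 1 - r * (t - 1) := fun t ht => by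
    by_cases h : t = 1
    · simp [h]
    · exact (hconv t ht h).le
  have hsub1 : Integrable (fun x => ‖f x‖ ^ r - 1) (haarProb G) := hfr.sub (integrable_const _)
  have hsub2 : Integrable (fun x => r * (‖f x‖ - 1)) (haarProb G) :=
    (hfi.norm.sub (integrable_const _)).const_mul r
  have h3 : ∫ x, (‖f x‖ ^ r - 1 - r * (‖f x‖ - 1)) ∂(haarProb G) ≤ 0 := by
    rw [integral_sub hsub1 hsub2, integral_sub hfr (integrable_const _), integral_const_mul,
      integral_sub hfi.norm (integrable_const _)]
    simp only [integral_const, probReal_univ, smul_eq_mul, mul_one]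
    nlinarith
  have hae : ∀ᵐ x ∂(haarProb G), ‖f x‖ = 1 := by
    have h4 := (integral_eq_zero_iff_of_nonneg (fun x => hconv' ‖f x‖ (norm_nonneg _))
      (hsub1.sub hsub2)).1 (le_antisymm h3 (integral_nonneg fun x => hconv' _ (norm_nonneg _)))
    filter_upwards [h4] with x hx
    by_contra h
    exact (hconv _ (norm_nonneg _) h).ne' hx
  have hint := integrable_mul_char p f γ
  have hre : ∫ x, (f x * (starRingEnd ℂ) (γ x : ℂ)).re ∂(haarProb G) = 1 := by
    have h5 : (∫ x, f x * (starRingEnd ℂ) (γ x : ℂ) ∂(haarProb G)).re = 1 := by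
      rw [← fourierCoeffAt_apply, hγ, Complex.one_re]
    rw [← h5]
    exact integral_re hint
  -- A function of modulus 1 whose integral is 1 has real part 1 almost everywhere, hence equals 1
  -- there.
  have h6 : (fun x => 1 - (f x * (starRingEnd ℂ) (γ x : ℂ)).re) =ᵐ[haarProb G] 0 := by
    refine (integral_eq_zero_iff_of_nonneg_ae ?_ ((integrable_const _).sub hint.re)).1 ?_
    · filter_upwards [hae] with x hx
      have h7 := Complex.re_le_norm (f x * (starRingEnd ℂ) (γ x : ℂ))
      rw [norm_mul, RCLike.norm_conj, Circle.norm_coe, mul_one, hx] at h7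
      exact sub_nonneg.2 h7
    · refine (integral_sub (integrable_const _) hint.re).trans ?_
      have h8 : ∫ x, RCLike.re (f x * (starRingEnd ℂ) (γ x : ℂ)) ∂(haarProb G) = 1 := hre
      rw [h8]
      simp
  refine Lp.ext (Filter.EventuallyEq.trans ?_
    (ContinuousMap.coeFn_toLp (p := p) (𝕜 := ℂ) (haarProb G) (charC γ)).symm)
  filter_upwards [hae, h6] with x hx hx'
  set w := f x * (starRingEnd ℂ) (γ x : ℂ) with hw
  have hw1 : w.re = 1 := (sub_eq_zero.1 hx').symm
  have hwn : ‖w‖ = 1 := by rw [hw, norm_mul, RCLike.norm_conj, Circle.norm_coe, mul_one, hx]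
  have hw2 : w = 1 := by
    have h9 := Complex.sq_norm w
    rw [hwn, Complex.normSq_apply, hw1] at h9
    refine Complex.ext hw1 ?_
    rw [Complex.one_im]
    nlinarith
  have h10 : (starRingEnd ℂ) (γ x : ℂ) * (γ x : ℂ) = 1 := by
    rw [mul_comm, Complex.mul_conj, Circle.normSq_coe, Complex.ofReal_one]
  calc f x = w * (γ x : ℂ) := by rw [hw, mul_assoc, h10, mul_one]
    _ = charC γ x := by rw [hw2, one_mul, charC_apply]

/-- For `1 < p < ∞`, a linear isometry between Hardy spaces is determined by where it preserves
Fourier coefficients, as long as these are all coefficients on its domain. -/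
theorem linearIsometry_ext_of_fourierCoeffAt (hp1 : 1 < p) (hp : p ≠ ∞) (hE : E ⊆ Set.range χ)
    {H : Type*} [CommGroup H] [TopologicalSpace H] [IsTopologicalGroup H] [CompactSpace H]
    [T2Space H] [MeasurableSpace H] [BorelSpace H] {E' : Set (PontryaginDual H)}
    {χ' : I → PontryaginDual H} {S T : hardy p E →ₗᵢ[ℂ] hardy p E'}
    (hS : ∀ f i, fourierCoeffAt p (χ' i) (S f) = fourierCoeffAt p (χ i) f)
    (hT : ∀ f i, fourierCoeffAt p (χ' i) (T f) = fourierCoeffAt p (χ i) f) : S = T := by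
  let K : Submodule ℂ (hardy p E) := LinearMap.eqLocus S.toLinearMap T.toLinearMap
  have hK : IsClosed (K : Set (hardy p E)) := isClosed_eq S.continuous T.continuous
  have hK' : IsClosed (K.map (hardy p E).subtype : Set (Lp ℂ p (haarProb G))) :=
    (isClosed_hardy p E).isClosedEmbedding_subtypeVal.isClosedMap _ hK
  -- The image of a character has norm at most 1 and one coefficient equal to 1, so extremality
  -- identifies it.
  have key : ∀ U : hardy p E →ₗᵢ[ℂ] hardy p E',
      (∀ f i, fourierCoeffAt p (χ' i) (U f) = fourierCoeffAt p (χ i) f) →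
      ∀ i (h : χ i ∈ E), (U ⟨charLp p (χ i), charLp_mem_hardy p h⟩ : Lp ℂ p (haarProb H)) =
        charLp p (χ' i) := fun U hU i h => by
    refine eq_charLp_of_norm_le_one hp1 hp ?_ ?_
    · exact (U.norm_map _).trans_le (norm_charLp_le (χ i))
    · rw [hU]
      exact fourierCoeffAt_charLp_self p _
  have hle : hardy p E ≤ K.map (hardy p E).subtype := by
    refine (hardy_le_closure_span hp E).trans (Submodule.topologicalClosure_minimal _ ?_ hK')
    rw [Submodule.span_le]
    rintro _ ⟨γ, hγ, rfl⟩
    obtain ⟨i, rfl⟩ := hE hγ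
    refine ⟨⟨_, charLp_mem_hardy p hγ⟩, Subtype.ext ?_, rfl⟩
    exact (key S hS i hγ).trans (key T hT i hγ).symm
  refine LinearIsometry.ext fun f => ?_
  obtain ⟨g, hg, hgf⟩ := hle f.2
  have : g = f := Subtype.ext hgf
  subst this
  exact hg

end CoefficientSpaces

/-! ### Multi-indices and prime factorizations. -/

section PrimePowers

theorem prime_nthPrime (k : ℕ) : (nthPrime k).Prime := Nat.prime_nth_prime k

theorem primePower_ne_zero {N : ℕ∞} (α : Ix N →₀ ℤ) : primePower α ≠ 0 :=
  Finset.prod_ne_zero_iff.2 fun k _ => pow_ne_zero _ (prime_nthPrime k).ne_zero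

theorem factorization_primePower (α : Ix ⊤ →₀ ℤ) (k : Ix ⊤) :
    (primePower α).factorization (nthPrime k) = (α k).toNat := by
  rw [primePower, Nat.factorization_prod (g := fun i : Ix ⊤ => nthPrime i ^ (α i).toNat)
      fun i _ => pow_ne_zero _ (prime_nthPrime i).ne_zero,
    Finsupp.finsetSum_apply, Finset.sum_eq_single k]
  · rw [(prime_nthPrime k).factorization_pow, Finsupp.single_eq_same]
  · intro i _ hi
    rw [(prime_nthPrime i).factorization_pow, Finsupp.single_eq_of_ne]
    exact fun h => hi (nthPrime_injective h).symm
  · intro hk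
    rw [Finsupp.notMem_support_iff.1 hk]
    simp

theorem primeExponents_apply (m : ℕ+) (k : Ix ⊤) :
    primeExponents m k = ((m : ℕ).factorization (nthPrime k) : ℤ) := rfl

theorem primeExponents_eq {m : ℕ+} {α : Ix ⊤ →₀ ℤ} (hα : 0 ≤ α) (h : (m : ℕ) = primePower α) :
    primeExponents m = α := Finsupp.ext fun k => by
  rw [primeExponents_apply, h, factorization_primePower, Int.toNat_of_nonneg (hα k)]

theorem primePower_primeExponents (m : ℕ+) : primePower (primeExponents m) = m := by
  refine Nat.eq_of_factorization_eq (primePower_ne_zero _) m.ne_zero fun q => ?_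
  by_cases hq : q.Prime
  -- A prime occurs in the enumeration at the index counting the smaller primes.
  · obtain ⟨k, rfl⟩ : ∃ k, nthPrime k = q := ⟨_, Nat.nth_count hq⟩
    exact (factorization_primePower _ ⟨k, ENat.natCast_lt_top k⟩).trans (Int.toNat_natCast _)
  · rw [Nat.factorization_eq_zero_of_not_prime _ hq, Nat.factorization_eq_zero_of_not_prime _ hq]

theorem exists_primeExponents_eq {α : Ix ⊤ →₀ ℤ} (hα : 0 ≤ α) : ∃ m, primeExponents m = α :=
  ⟨⟨primePower α, Nat.pos_of_ne_zero (primePower_ne_zero α)⟩, primeExponents_eq hα rfl⟩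

/-- The inclusion of `{1, …, N}` in `{1, 2, …}`. -/
def ixEmbedding (N : ℕ∞) : Ix N ↪ Ix ⊤ :=
  ⟨fun k => ⟨k, ENat.natCast_lt_top k⟩,
    fun _ _ h => Subtype.ext (congrArg (fun i : Ix ⊤ => (i : ℕ)) h)⟩

theorem primePower_embDomain {N : ℕ∞} (α : Ix N →₀ ℤ) :
    primePower (α.embDomain (ixEmbedding N)) = primePower α := by
  rw [primePower, Finsupp.support_embDomain, Finset.prod_map]
  refine Finset.prod_congr rfl fun k _ => ?_
  rw [Finsupp.embDomain_apply_self]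
  rfl

end PrimePowers

/-! ### The main theorem -/

section Main

theorem existsUnique_linearIsometryEquiv {V W I : Type*} [SeminormedAddCommGroup V]
    [NormedSpace ℂ V] [SeminormedAddCommGroup W] [NormedSpace ℂ W] {v : V → I → ℂ}
    {w : W → I → ℂ} (hw : Function.Injective w) (e : V ≃ₗᵢ[ℂ] W)
    (he : ∀ x i, w (e x) i = v x i) : ∃! e : V ≃ₗᵢ[ℂ] W, ∀ x i, w (e x) i = v x i :=
  ⟨e, he, fun _ h => LinearIsometryEquiv.ext fun x =>
    hw (funext fun i => (h x i).trans (he x i).symm)⟩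

theorem IsLambdaDirichletGroup.subset_range_char {G : Type*} [CommGroup G] [TopologicalSpace G]
    {lam : ℕ → ℝ} {β : ℝ → G} (hβ : IsLambdaDirichletGroup lam β) :
    {γ | ∃ n, Extends β (lam n) γ} ⊆ Set.range hβ.char := by
  rintro γ ⟨n, hn⟩
  exact ⟨n, (hβ.char_spec n).unique hβ.toIsDirichletGroup hn⟩

theorem ordinary_subset_range : {γ : PontryaginDual (Torus ⊤) | ∃ α, 0 ≤ α ∧ γ = monomialChar α} ⊆
    Set.range fun m : ℕ+ => monomialChar (primeExponents m) := by
  rintro _ ⟨α, hα, rfl⟩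
  obtain ⟨m, rfl⟩ := exists_primeExponents_eq hα
  exact ⟨m, rfl⟩

variable {N : ℕ∞} {R : ℕ → (Ix N →₀ ℚ)}

theorem IsRow.intRow_eq {n : ℕ} {α : Ix N →₀ ℤ} (h : IsRow R n α) {L : ℕ∞} (j : Ix N ↪ Ix L) :
    intRow j (R n) = α.embDomain j := by
  rw [intRow, h.mapRange_num]

theorem IsNaturalMatrix.isIntegerMatrix (hR : IsNaturalMatrix R) : IsIntegerMatrix R := fun n k => by
  obtain ⟨a, ha⟩ := hR n k
  exact ⟨a, by rw [ha, Int.cast_natCast]⟩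

theorem IsNaturalMatrix.intRow_nonneg (hR : IsNaturalMatrix R) (n : ℕ) {L : ℕ∞}
    (j : Ix N ↪ Ix L) : 0 ≤ intRow j (R n) := fun k => by
  by_cases hk : k ∈ Set.range j
  · obtain ⟨i, rfl⟩ := hk
    obtain ⟨a, ha⟩ := hR n i
    rw [intRow, Finsupp.embDomain_apply_self, Finsupp.mapRange_apply, ha, Rat.num_natCast]
    exact Int.natCast_nonneg a
  · rw [intRow, Finsupp.embDomain_of_notMem_range _ _ _ hk]
    exact le_rfl

variable {lam : ℕ → ℝ} {B : Ix N → ℝ} {p : ℝ≥0∞} [Fact (1 ≤ p)]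
  {G : Type*} [CommGroup G] [TopologicalSpace G] [IsTopologicalGroup G] [CompactSpace G]
  [T2Space G] [MeasurableSpace G] [BorelSpace G] {β : ℝ → G}

theorem exists_equiv_hardyDirichlet (p : ℝ≥0∞) [Fact (1 ≤ p)] (hRB : IsDecomposition lam R B)
    (hβ : IsLambdaDirichletGroup lam β) :
    ∃ e : hardyRow p R ≃ₗᵢ[ℂ] HardyDirichlet p hβ,
      ∀ F n, (e F).coeff n = fourierCoeffAt p (evalChar (rowOf R n)) F := by
  obtain ⟨e, he⟩ := exists_equiv_hardyLambda p hβ hRB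
  exact ⟨e.trans (coeffEquiv hβ.subset_range_char), fun F n => he F n⟩

/-- Rows padded by zeros are nonnegative multi-indices, so the torus model lies isometrically in the
Hardy space of the infinite torus; it has no spectrum outside the rows, whence the vanishing
coefficients. -/
theorem exists_ordinary_isometry (p : ℝ≥0∞) [Fact (1 ≤ p)] (hRB : IsDecomposition lam R B)
    (hβ : IsLambdaDirichletGroup lam β) (hR : IsNaturalMatrix R) :
    ∃ ψ : HardyDirichlet p hβ →ₗᵢ[ℂ] HardyOrdinary p,
      (∀ D n α (m : ℕ+), IsRow R n α → (m : ℕ) = primePower α → (ψ D).coeff m = D.coeff n) ∧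
      (∀ D (m : ℕ+), (∀ n α, IsRow R n α → (m : ℕ) ≠ primePower α) → (ψ D).coeff m = 0) := by
  obtain ⟨e, he⟩ := exists_equiv_hardyDirichlet p hRB hβ
  obtain ⟨t, ht⟩ := exists_equiv_hardy_torus p hR.isIntegerMatrix (ixEmbedding N) rfl
  have hle : hardy p (Set.range fun n => monomialChar (intRow (ixEmbedding N) (R n))) ≤
      hardy p {γ : PontryaginDual (Torus ⊤) | ∃ α, 0 ≤ α ∧ γ = monomialChar α} := by
    intro f hf γ hγ
    obtain ⟨n, rfl⟩ := hf γ hγ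
    exact ⟨_, hR.intRow_nonneg n _, rfl⟩
  let ι : hardy p (Set.range fun n => monomialChar (intRow (ixEmbedding N) (R n))) →ₗᵢ[ℂ]
      hardy p {γ : PontryaginDual (Torus ⊤) | ∃ α, 0 ≤ α ∧ γ = monomialChar α} :=
    { toLinearMap := Submodule.inclusion hle
      norm_map' := fun _ => rfl }
  have hcoeff : ∀ D m, (coeffEquiv (p := p) ordinary_subset_range (ι (t (e.symm D)))).coeff m =
      fourierCoeffAt p (monomialChar (primeExponents m)) (t (e.symm D)) := fun _ _ => rfl
  refine ⟨(coeffEquiv (p := p) ordinary_subset_range).toLinearIsometry.comp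
    (ι.comp (t.toLinearIsometry.comp e.symm.toLinearIsometry)), fun D n α m hα hm => ?_,
    fun D m hm => ?_⟩
  · refine (hcoeff D m).trans ?_
    have h1 : primeExponents m = intRow (ixEmbedding N) (R n) := primeExponents_eq
      (hR.intRow_nonneg n _) (by rw [hα.intRow_eq, primePower_embDomain, hm])
    rw [h1, ht, ← he, LinearIsometryEquiv.apply_symm_apply]
  · refine (hcoeff D m).trans ?_
    by_contra h
    obtain ⟨n, hn⟩ := (t (e.symm D)).2 _ h
    obtain ⟨α, hα⟩ := hR.isIntegerMatrix.exists_isRow n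
    refine hm n α hα ?_
    rw [← primePower_primeExponents, ← monomialChar_injective hn, hα.intRow_eq,
      primePower_embDomain]

/-- Passing from coefficients back to functions on both sides makes the extremality of characters
applicable; nothing is assumed about the coefficients away from the rows. -/
theorem ordinary_isometry_unique (hp1 : 1 < p) (hp : p ≠ ∞)
    (hβ : IsLambdaDirichletGroup lam β) (hR : IsNaturalMatrix R)
    {ψ φ : HardyDirichlet p hβ →ₗᵢ[ℂ] HardyOrdinary p}
    (hψ : ∀ D n α (m : ℕ+), IsRow R n α → (m : ℕ) = primePower α → (ψ D).coeff m = D.coeff n)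
    (hφ : ∀ D n α (m : ℕ+), IsRow R n α → (m : ℕ) = primePower α → (φ D).coeff m = D.coeff n) :
    ψ = φ := by
  let c := coeffEquiv (p := p) hβ.subset_range_char
  let o := coeffEquiv (p := p) ordinary_subset_range
  have key : ∀ θ : HardyDirichlet p hβ →ₗᵢ[ℂ] HardyOrdinary p,
      (∀ D n α (m : ℕ+), IsRow R n α → (m : ℕ) = primePower α → (θ D).coeff m = D.coeff n) →
      ∀ f n, fourierCoeffAt p (monomialChar (intRow (ixEmbedding N) (R n)))
        ((o.symm.toLinearIsometry.comp (θ.comp c.toLinearIsometry)) f) =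
          fourierCoeffAt p (hβ.char n) f := by
    intro θ hθ f n
    obtain ⟨α, hα⟩ := hR.isIntegerMatrix.exists_isRow n
    obtain ⟨m, hm⟩ := exists_primeExponents_eq (hR.intRow_nonneg n (ixEmbedding N))
    have hm' : (m : ℕ) = primePower α := by
      rw [← primePower_primeExponents, hm, hα.intRow_eq, primePower_embDomain]
    rw [← hm]
    exact (fourierCoeffAt_coeffEquiv_symm ordinary_subset_range (θ (c f)) m).trans
      (hθ (c f) n α m hα hm')
  have h := linearIsometry_ext_of_fourierCoeffAt hp1 hp hβ.subset_range_char (key ψ hψ) (key φ hφ)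
  refine LinearIsometry.ext fun D => o.symm.injective ?_
  have h1 := DFunLike.congr_fun h (c.symm D)
  change o.symm (ψ (c (c.symm D))) = o.symm (φ (c (c.symm D))) at h1
  rwa [c.apply_symm_apply] at h1

end Main

theorem mainTheorem11 {N : ℕ∞} (lam : ℕ → ℝ) (hlam : IsFrequency lam)
    (R : ℕ → (Ix N →₀ ℚ)) (B : Ix N → ℝ) (hRB : IsDecomposition lam R B)
    (p : ℝ≥0∞) [Fact (1 ≤ p)]
    {G : Type*} [CommGroup G] [TopologicalSpace G] [IsTopologicalGroup G] [CompactSpace G]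
    [T2Space G] [MeasurableSpace G] [BorelSpace G]
    (β : ℝ → G) (hβ : IsLambdaDirichletGroup lam β) :
    -- the norm of a Dirichlet series is the norm of the function which represents it
    (∀ f : hardyLambda p lam β, ‖bohrMap p hβ f‖ = ‖f‖) ∧
    -- the three spaces agree, for an arbitrary Bohr matrix
    (∃! Φ : hardyQDual p R ≃ₗᵢ[ℂ] HardyDirichlet p hβ,
      ∀ F n, (Φ F).coeff n = fourierCoeffAt p (rowChar (R n)) F) ∧
    (∃! Ψ : HardyDirichlet p hβ ≃ₗᵢ[ℂ] hardyLambda p lam bohrEmbedding,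
      ∀ D n, fourierCoeffAt p (evalChar (lam n)) (Ψ D) = D.coeff n) ∧
    (∃! Θ : hardyQDual p R ≃ₗᵢ[ℂ] hardyLambda p lam bohrEmbedding,
      ∀ F n, fourierCoeffAt p (evalChar (lam n)) (Θ F) =
        fourierCoeffAt p (rowChar (R n)) F) ∧
    -- integer type
    (IsIntegerMatrix R →
      ∃! ψ : HardyDirichlet p hβ ≃ₗᵢ[ℂ] hardyTorus p R,
        ∀ D n α, IsRow R n α → fourierCoeffAt p (monomialChar α) (ψ D) = D.coeff n) ∧
    -- natural type
    (IsNaturalMatrix R →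
      (∃! ψ : HardyDirichlet p hβ →ₗᵢ[ℂ] HardyOrdinary p,
        (∀ D n α (m : ℕ+), IsRow R n α → (m : ℕ) = primePower α →
          (ψ D).coeff m = D.coeff n) ∧
        (∀ D (m : ℕ+), (∀ n α, IsRow R n α → (m : ℕ) ≠ primePower α) →
          (ψ D).coeff m = 0)) ∧
      (1 < p → p < ∞ →
        ∃! ψ : HardyDirichlet p hβ →ₗᵢ[ℂ] HardyOrdinary p,
          ∀ D n α (m : ℕ+), IsRow R n α → (m : ℕ) = primePower α →
            (ψ D).coeff m = D.coeff n)) := by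

  obtain ⟨eD, heD⟩ := exists_equiv_hardyDirichlet p hRB hβ
  obtain ⟨eB, heB⟩ := exists_equiv_hardyBohr p hRB
  obtain ⟨eQ, heQ⟩ := exists_equiv_hardyQDual p R
  have hD : Function.Injective (CoeffSpace.coeff : HardyDirichlet p hβ → ℕ → ℂ) :=
    fun D D' h => CoeffSpace.ext fun n => congrFun h n
  have hBsub : {γ | ∃ n, Extends bohrEmbedding (lam n) γ} ⊆
      Set.range fun n => evalChar (lam n) := by
    rintro γ ⟨n, hn⟩
    exact ⟨n, (extends_bohrEmbedding_iff.1 hn).symm⟩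
  have hB : Function.Injective fun (f : hardyLambda p lam bohrEmbedding) n =>
      fourierCoeffAt p (evalChar (lam n)) f :=
    fun f g h => hardy_ext hBsub fun n => congrFun h n
  -- Each isometry is the composite of two equivalences through the row group; uniqueness holds
  -- because the target's elements are determined by the prescribed coefficients, except in the last
  -- case.
  refine ⟨RangeSpace.norm_mk_of_injective (coeffMap_injective hβ.subset_range_char), ?_, ?_, ?_,
    fun hR => ?_, fun hR => ⟨?_, fun hp1 hp => ?_⟩⟩
  · refine existsUnique_linearIsometryEquiv hD (eQ.symm.trans eD) fun F n => ?_
    rw [LinearIsometryEquiv.trans_apply, heD, ← heQ, LinearIsometryEquiv.apply_symm_apply]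
  · refine existsUnique_linearIsometryEquiv hB (eD.symm.trans eB) fun D n => ?_
    rw [LinearIsometryEquiv.trans_apply, heB, ← heD, LinearIsometryEquiv.apply_symm_apply]
  · refine existsUnique_linearIsometryEquiv hB (eQ.symm.trans eB) fun F n => ?_
    rw [LinearIsometryEquiv.trans_apply, heB, ← heQ, LinearIsometryEquiv.apply_symm_apply]
  · have hrow : ∀ n α, IsRow R n α → intRow (Function.Embedding.refl _) (R n) = α :=
      fun n α hα => (hα.intRow_eq _).trans (congrFun Finsupp.embDomain_refl α)
    have hE : {γ | ∃ n α, IsRow R n α ∧ γ = monomialChar α} =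
        Set.range fun n => monomialChar (intRow (Function.Embedding.refl _) (R n)) := by
      ext γ
      refine exists_congr fun n => ⟨?_, fun h => ?_⟩
      · rintro ⟨α, hα, rfl⟩
        exact congrArg monomialChar (hrow n α hα)
      · obtain ⟨α, hα⟩ := hR.exists_isRow n
        exact ⟨α, hα, by rw [← h, ← hrow n α hα]⟩
    obtain ⟨eT, heT⟩ := exists_equiv_hardy_torus p hR (Function.Embedding.refl _) hE
    have hT : ∀ D n α, IsRow R n α →
        fourierCoeffAt p (monomialChar α) (eT (eD.symm D)) = D.coeff n := by
      intro D n α hα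
      rw [← hrow n α hα, heT, ← heD, LinearIsometryEquiv.apply_symm_apply]
    refine ⟨eD.symm.trans eT, hT, fun ψ hψ => LinearIsometryEquiv.ext fun D =>
      hardy_ext hE.subset fun n => ?_⟩
    obtain ⟨α, hα⟩ := hR.exists_isRow n
    rw [hrow n α hα, hψ D n α hα]
    exact (hT D n α hα).symm
  · obtain ⟨ψ, hψ, hψ0⟩ := exists_ordinary_isometry p hRB hβ hR
    refine ⟨ψ, ⟨hψ, hψ0⟩, fun φ hφ => LinearIsometry.ext fun D => CoeffSpace.ext fun m => ?_⟩
    by_cases h : ∃ n α, IsRow R n α ∧ (m : ℕ) = primePower α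
    · obtain ⟨n, α, hα, hm⟩ := h
      rw [hψ D n α m hα hm, hφ.1 D n α m hα hm]
    · have h' : ∀ n α, IsRow R n α → (m : ℕ) ≠ primePower α :=
        fun n α hα hm => h ⟨n, α, hα, hm⟩
      rw [hψ0 D m h', hφ.2 D m h']
  · obtain ⟨ψ, hψ, -⟩ := exists_ordinary_isometry p hRB hβ hR
    exact ⟨ψ, hψ, fun φ hφ => ordinary_isometry_unique hp1 hp.ne hβ hR hφ hψ⟩
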